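/- Let $(R,\mathfrak m)$ be a Cohen–Macaulay (Noetherian) local ring of dimension $d\ge 1$ with infinite residue field, let $I$ be an $\mathfrak m$-primary ideal, and let $J\subseteq I$ be a minimal reduction of $I$, i.e. $J$ is minimal with respect to inclusion among the ideals $K\subseteq I$ with $I^{n+1}=KI^n$ for some $n\ge 0$. Let $F(I)=\bigoplus_{n\ge0}I^n/\mathfrak m I^n$ be the fiber cone and $G(I)=\bigoplus_{n\ge0}I^n/I^{n+1}$ the associated graded ring of $I$; $\operatorname{depth}$ of each of these rings is taken with respect to its homogeneous maximal ideal. Let $r^{\mathfrak m}_J(I)=\min\{n\ge 0 : \mathfrak m I^{n+1}=\mathfrak m JI^n\}$ be the $\mathfrak m$-reduction number of $I$ with respect to $J$. (1) If $\mathfrak m I^n\cap J=\mathfrak m I^{n-1}J$ for all $n\ge 1$, then $\operatorname{depth}F(I)>0$. (2) If $r^{\mathfrak m}_J(I)=1$, then for every integer $t$ with $1\le t\le d$: if $\operatorname{depth}G(I)\ge d-t$, then $\operatorname{depth}F(I)\ge d-t+1$. -/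

import Mathlib

open IsLocalRing

noncomputable section

/-- The grade of an ideal `𝔞` of `A`: the supremum of the lengths of the `A`-regular sequences
whose terms all lie in `𝔞`. -/
def idealGrade {A : Type*} [CommRing A] (𝔞 : Ideal A) : ℕ∞ :=
  ⨆ (rs : List A) (_ : (∀ r ∈ rs, r ∈ 𝔞) ∧ RingTheory.Sequence.IsRegular A rs), (rs.length : ℕ∞)

/-- A Noetherian local ring is Cohen-Macaulay if its depth, i.e. the grade of its maximal ideal,
equals its Krull dimension. -/
structure IsCohenMacaulayLocal (R : Type*) [CommRing R] [IsLocalRing R] : Prop where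
  noetherian : IsNoetherianRing R
  depth_eq_dim : (idealGrade (maximalIdeal R) : WithBot ℕ∞) = ringKrullDim R

/-- `I` is `𝔪`-primary, where `𝔪` is the maximal ideal. -/
def IsMaximalPrimary {R : Type*} [CommRing R] [IsLocalRing R] (I : Ideal R) : Prop :=
  I.IsPrimary ∧ I.radical = maximalIdeal R

/-- `J ⊆ I` is a reduction of `I` with respect to the module `M`: `Iⁿ⁺¹M = JIⁿM` for some `n`. -/
def IsReductionWrt {R : Type*} [CommRing R] (M : Type*) [AddCommGroup M] [Module R M]
    (I J : Ideal R) : Prop :=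
  J ≤ I ∧ ∃ n : ℕ, I ^ (n + 1) • (⊤ : Submodule R M) = (J * I ^ n) • (⊤ : Submodule R M)

/-- The `M`-reduction number `r^M_J(I) = min {n | Iⁿ⁺¹M = JIⁿM}` of `I` with respect to a
reduction `J` of `I` with respect to `M`. -/
def reductionNumberWrt {R : Type*} [CommRing R] (M : Type*) [AddCommGroup M] [Module R M]
    (I J : Ideal R) : ℕ :=
  sInf {n : ℕ | I ^ (n + 1) • (⊤ : Submodule R M) = (J * I ^ n) • (⊤ : Submodule R M)}

/-- `J` is a minimal reduction of `I`: minimal with respect to inclusion among the reductions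
of `I` (with respect to the module `R`). -/
def IsMinimalReduction {R : Type*} [CommRing R] (I J : Ideal R) : Prop :=
  Minimal (fun K : Ideal R => IsReductionWrt R I K) J

/-- The ideal `⨁ₙ 𝔞Iⁿtⁿ` of the Rees algebra `⨁ₙ Iⁿtⁿ ⊆ R[t]`. -/
def reesCoeffIdeal {R : Type*} [CommRing R] (𝔞 I : Ideal R) : Ideal (reesAlgebra I) where
  carrier := {f | ∀ n : ℕ, (f : Polynomial R).coeff n ∈ 𝔞 * I ^ n}
  zero_mem' := fun n => by simp
  add_mem' := fun {f g} hf hg n => by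
    simpa using add_mem (hf n) (hg n)
  smul_mem' := fun c f hf n => by
    have h : ((c • f : reesAlgebra I) : Polynomial R) = (c : Polynomial R) * f := rfl
    rw [h, Polynomial.coeff_mul]
    refine Ideal.sum_mem _ fun p hp => ?_
    have hc : (c : Polynomial R).coeff p.1 ∈ I ^ p.1 := c.2 p.1
    have hm := Ideal.mul_mem_mul hc (hf p.2)
    rwa [mul_left_comm, ← pow_add, Finset.HasAntidiagonal.mem_antidiagonal.mp hp] at hm

/-- The graded ring `⨁ₙ Iⁿ/𝔞Iⁿ`, as the quotient of `⨁ₙ Iⁿtⁿ` by `⨁ₙ 𝔞Iⁿtⁿ`. -/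
abbrev formRing {R : Type*} [CommRing R] (𝔞 I : Ideal R) : Type _ :=
  reesAlgebra I ⧸ reesCoeffIdeal 𝔞 I

/-- The associated graded ring `G(I) = ⨁ₙ Iⁿ/Iⁿ⁺¹`. -/
abbrev associatedGradedRing {R : Type*} [CommRing R] (I : Ideal R) : Type _ := formRing I I

/-- The fiber cone `F(I) = ⨁ₙ Iⁿ/𝔪Iⁿ`. -/
abbrev fiberCone {R : Type*} [CommRing R] [IsLocalRing R] (I : Ideal R) : Type _ :=
  formRing (maximalIdeal R) I

/-- The ideal `𝔪/𝔞 ⊕ ⨁_{n ≥ 1} Iⁿ/𝔞Iⁿ` of `⨁ₙ Iⁿ/𝔞Iⁿ`: the image of the ideal of those elements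
of the Rees algebra whose degree-zero coefficient lies in `𝔪`. For a proper ideal `𝔞` it is the
unique homogeneous maximal ideal. -/
def homogeneousMaximalIdeal {R : Type*} [CommRing R] [IsLocalRing R] (𝔞 I : Ideal R) :
    Ideal (formRing 𝔞 I) :=
  ((maximalIdeal R).comap
    (Polynomial.constantCoeff.comp (algebraMap (reesAlgebra I) (Polynomial R)))).map
    (Ideal.Quotient.mk (reesCoeffIdeal 𝔞 I))

/-- `depth G(I)`, with respect to the homogeneous maximal ideal of `G(I)`. -/
def depthAssociatedGraded {R : Type*} [CommRing R] [IsLocalRing R] (I : Ideal R) : ℕ∞ :=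
  idealGrade (A := associatedGradedRing I) (homogeneousMaximalIdeal I I)

/-- `depth F(I)`, with respect to the homogeneous maximal ideal of `F(I)`. -/
def depthFiberCone {R : Type*} [CommRing R] [IsLocalRing R] (I : Ideal R) : ℕ∞ :=
  idealGrade (A := fiberCone I) (homogeneousMaximalIdeal (maximalIdeal R) I)

end

/-! Let `A` be the Rees algebra of `I`, `G = A/IA`, `F = A/𝔪A`, and let `L` be the graded module of
the filtration `R ⊇ 𝔪 ⊇ 𝔪I ⊇ 𝔪I² ⊇ ⋯`. The cokernel of `F → L` is `⨁ 𝔪Iⁿ⁻¹/Iⁿ` over `n ≥ 1`, which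
up to a degree shift is `N = 𝔪A/IA`, the kernel of `G → F`. So there are exact sequences `0 → F → L
→ N → 0` and `0 → N → G → F → 0`. Measuring depth by vanishing of Ext over `A`, they show that
`depth L ≥ d`, `depth G ≥ s` and `s < d` imply `depth F ≥ s + 1`
(`ExtVanishesBelow.of_exact_of_exact`).

The bound `depth L ≥ d` is a Valabrega–Valla argument: if `J` is generated by a regular sequence
`x₀, …` of length `d` and `J ∩ 𝔪Iⁿ ⊆ J𝔪Iⁿ⁻¹` for `n ≥ 1`, then the `xᵢt` form a regular sequence on
`L` (`IsReesAlgebra.isSMulRegular_of_isRegularChain`).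

Such a regular sequence exists because minimal generators of `J` are analytically independent, so
comparing growth of the length of `R/Jⁿ` bounds their number by `d`
(`IsMinimalReduction.spanFinrank_le`), and depth `d` then allows regular generators
(`exists_isRegularChain`). Part (1) is the case `s = 0`. In part (2) the intersection condition is
automatic: for `n ≥ 2` from the reduction number, for `n = 1` from minimality of `J`. -/

/-! ### Vanishing of Ext as a measure of depth -/

section ExtVanishing
universe u
open CategoryTheory Abelian RingTheory.Sequence

variable {A : Type u} [CommRing A]

/-- `Extⁱ(A/𝔞, M) = 0` for all `i < n`. -/
def ExtVanishesBelow (𝔞 : Ideal A) (M : Type u) [AddCommGroup M] [Module A M] (n : ℕ) : Prop :=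
  ∀ i < n, Subsingleton (Ext (ModuleCat.of A (A ⧸ 𝔞)) (ModuleCat.of A M) i)

variable {𝔞 : Ideal A} {X Y Z : Type u} [AddCommGroup X] [Module A X] [AddCommGroup Y] [Module A Y]
  [AddCommGroup Z] [Module A Z]

lemma ExtVanishesBelow.mono {n m : ℕ} (h : ExtVanishesBelow 𝔞 X n) (hm : m ≤ n) :
    ExtVanishesBelow 𝔞 X m := fun i hi => h i (hi.trans_le hm)

/-- The short exact sequence of `ModuleCat` attached to a short exact sequence of linear maps. -/
lemma exists_shortExact_of_exact (f : X →ₗ[A] Y) (g : Y →ₗ[A] Z) (hf : Function.Injective f)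
    (hg : Function.Surjective g) (h : Function.Exact f g) :
    (ModuleCat.shortComplexOfCompEqZero f g h.linearMap_comp_eq_zero).ShortExact where
  exact := ModuleCat.shortComplex_exact _ h
  mono_f := by simpa [ModuleCat.shortComplexOfCompEqZero, ModuleCat.mono_iff_injective] using hf
  epi_g := by simpa [ModuleCat.shortComplexOfCompEqZero, ModuleCat.epi_iff_surjective] using hg

section
variable (f : X →ₗ[A] Y) (g : Y →ₗ[A] Z) (hf : Function.Injective f)
    (hg : Function.Surjective g) (h : Function.Exact f g) (i : ℕ)
include hf hg h

lemma subsingleton_ext_left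
    (hZ : Subsingleton (Ext (ModuleCat.of A (A ⧸ 𝔞)) (ModuleCat.of A Z) i))
    (hY : Subsingleton (Ext (ModuleCat.of A (A ⧸ 𝔞)) (ModuleCat.of A Y) (i + 1))) :
    Subsingleton (Ext (ModuleCat.of A (A ⧸ 𝔞)) (ModuleCat.of A X) (i + 1)) := by
  refine AddCommGrpCat.subsingleton_of_isZero <| ShortComplex.Exact.isZero_of_both_zeros
    (Ext.covariant_sequence_exact₁' (ModuleCat.of A (A ⧸ 𝔞))
      (exists_shortExact_of_exact f g hf hg h) i (i + 1) rfl) ?_ ?_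
  · exact (AddCommGrpCat.isZero_of_iff_subsingleton.mpr hZ).eq_zero_of_src _
  · exact (AddCommGrpCat.isZero_of_iff_subsingleton.mpr hY).eq_zero_of_tgt _

lemma subsingleton_ext_right
    (hY : Subsingleton (Ext (ModuleCat.of A (A ⧸ 𝔞)) (ModuleCat.of A Y) i))
    (hX : Subsingleton (Ext (ModuleCat.of A (A ⧸ 𝔞)) (ModuleCat.of A X) (i + 1))) :
    Subsingleton (Ext (ModuleCat.of A (A ⧸ 𝔞)) (ModuleCat.of A Z) i) := by
  refine AddCommGrpCat.subsingleton_of_isZero <| ShortComplex.Exact.isZero_of_both_zeros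
    (Ext.covariant_sequence_exact₃' (ModuleCat.of A (A ⧸ 𝔞))
      (exists_shortExact_of_exact f g hf hg h) i (i + 1) rfl) ?_ ?_
  · exact (AddCommGrpCat.isZero_of_iff_subsingleton.mpr hY).eq_zero_of_src _
  · exact (AddCommGrpCat.isZero_of_iff_subsingleton.mpr hX).eq_zero_of_tgt _

lemma ExtVanishesBelow.of_exact_right {n : ℕ} (hY : ExtVanishesBelow 𝔞 Y n)
    (hX : ExtVanishesBelow 𝔞 X (n + 1)) : ExtVanishesBelow 𝔞 Z n := fun i hi =>
  subsingleton_ext_right f g hf hg h i (hY i hi) (hX (i + 1) (by omega))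

end

lemma ExtVanishesBelow.congr {n : ℕ} (hX : ExtVanishesBelow 𝔞 X n) (e : X ≃ₗ[A] Y) :
    ExtVanishesBelow 𝔞 Y n := by
  intro i hi
  have hsub := hX i hi
  refine ⟨fun a b => ?_⟩
  have hid : ∀ a : Ext (ModuleCat.of A (A ⧸ 𝔞)) (ModuleCat.of A Y) i,
      a = (a.comp (Ext.mk₀ e.toModuleIso.inv) (add_zero i)).comp (Ext.mk₀ e.toModuleIso.hom)
        (add_zero i) := fun a => by
    rw [Ext.comp_assoc_of_third_deg_zero, Ext.mk₀_comp_mk₀, e.toModuleIso.inv_hom_id,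
      Ext.comp_mk₀_id]
  rw [hid a, hid b]
  congr 1
  exact Subsingleton.elim _ _

lemma subsingleton_ext_zero_iff :
    Subsingleton (Ext (ModuleCat.of A (A ⧸ 𝔞)) (ModuleCat.of A X) 0) ↔
      Subsingleton ((A ⧸ 𝔞) →ₗ[A] X) :=
  (Ext.addEquiv₀.trans ModuleCat.homAddEquiv).subsingleton_congr

lemma subsingleton_ext_zero_of_injective (f : X →ₗ[A] Y) (hf : Function.Injective f)
    (hY : Subsingleton (Ext (ModuleCat.of A (A ⧸ 𝔞)) (ModuleCat.of A Y) 0)) :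
    Subsingleton (Ext (ModuleCat.of A (A ⧸ 𝔞)) (ModuleCat.of A X) 0) := by
  rw [subsingleton_ext_zero_iff] at hY ⊢
  refine ⟨fun a b => LinearMap.ext fun x => hf ?_⟩
  exact LinearMap.congr_fun (Subsingleton.elim (f ∘ₗ a) (f ∘ₗ b)) x

/-- The connecting map raises degree by one, so the bound for `Z` may be one less; in degree 0 left
exactness of Hom suffices. -/
lemma ExtVanishesBelow.of_exact_left (f : X →ₗ[A] Y) (g : Y →ₗ[A] Z) (hf : Function.Injective f)
    (hg : Function.Surjective g) (h : Function.Exact f g) {n : ℕ} (hZ : ExtVanishesBelow 𝔞 Z n)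
    (hY : ExtVanishesBelow 𝔞 Y (n + 1)) : ExtVanishesBelow 𝔞 X (n + 1) := by
  intro i hi
  match i with
  | 0 => exact subsingleton_ext_zero_of_injective f hf (hY 0 hi)
  | i + 1 => exact subsingleton_ext_left f g hf hg h i (hZ i (by omega)) (hY _ hi)

/-- If `F` embeds into `L` with cokernel `N`, and `N` embeds into `G` with cokernel `F`, then
vanishing of `Ext` for `L` and `G` propagates to `F`, one degree further than for `G`. -/
lemma ExtVanishesBelow.of_exact_of_exact {F L N G : Type u} [AddCommGroup F] [Module A F]
    [AddCommGroup L] [Module A L] [AddCommGroup N] [Module A N] [AddCommGroup G] [Module A G]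
    (f : F →ₗ[A] L) (g : L →ₗ[A] N) (hf : Function.Injective f) (hg : Function.Surjective g)
    (hfg : Function.Exact f g)
    (f' : N →ₗ[A] G) (g' : G →ₗ[A] F) (hf' : Function.Injective f') (hg' : Function.Surjective g')
    (hfg' : Function.Exact f' g') {s : ℕ} (hL : ExtVanishesBelow 𝔞 L (s + 1))
    (hG : ExtVanishesBelow 𝔞 G s) : ExtVanishesBelow 𝔞 F (s + 1) := by
  induction s with
  | zero =>
    refine ExtVanishesBelow.of_exact_left f g hf hg hfg ?_ hL
    intro i hi
    omega
  | succ s ih =>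
    -- The bound on `F` passes to `N` through the second sequence, and the bound on `N` returns to
    -- `F` one degree higher through the first.
    have hF := ih (hL.mono (by omega)) (hG.mono (by omega))
    have hN : ExtVanishesBelow 𝔞 N (s + 1) :=
      ExtVanishesBelow.of_exact_left f' g' hf' hg' hfg' (hF.mono (by omega)) hG
    exact ExtVanishesBelow.of_exact_left f g hf hg hfg hN hL

/-- Multiplication by an element of `𝔞` that is regular on `X` raises the bound by one. -/
lemma ExtVanishesBelow.succ_of_exact_smul {x : A} (hx : x ∈ 𝔞) (hreg : IsSMulRegular X x)
    (g : X →ₗ[A] Z) (hg : Function.Surjective g) (h : Function.Exact (LinearMap.lsmul A X x) g)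
    {n : ℕ} (hZ : ExtVanishesBelow 𝔞 Z n) : ExtVanishesBelow 𝔞 X (n + 1) := by
  have hann : x ∈ Module.annihilator A (A ⧸ 𝔞) := by rwa [Ideal.annihilator_quotient]
  intro i hi
  match i with
  | 0 =>
    rw [subsingleton_ext_zero_iff]
    refine subsingleton_of_forall_eq 0 fun φ => LinearMap.ext fun a => hreg ?_
    simp only [LinearMap.zero_apply, smul_zero]
    rw [← map_smul, Module.mem_annihilator.mp hann a, map_zero]
  | i + 1 =>
    let g' := AddCommGrpCat.ofHom ((Ext.mk₀ (ModuleCat.shortComplexOfCompEqZero _ g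
      h.linearMap_comp_eq_zero).f).postcomp (ModuleCat.of A (A ⧸ 𝔞)) (add_zero (i + 1)))
    -- Multiplication by `x` on `Extⁱ⁺¹(A/𝔞, X)` is injective since `Extⁱ(A/𝔞, Z) = 0`, and zero
    -- since `x` kills `A/𝔞`.
    have mono_g : Mono g' := by
      apply (Ext.covariant_sequence_exact₁' (ModuleCat.of A (A ⧸ 𝔞))
        (exists_shortExact_of_exact (LinearMap.lsmul A X x) g hreg hg h) i (i + 1) rfl).mono_g
      exact (AddCommGrpCat.isZero_of_iff_subsingleton.mpr (hZ i (by omega))).eq_zero_of_src _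
    have zero_g : g' = 0 :=
      Ext.postcomp_smul_id_eq_zero_of_mem_annihilator hann (i + 1)
    exact AddCommGrpCat.subsingleton_of_isZero (Limits.IsZero.of_mono_eq_zero _ zero_g)

/-- Rees' theorem. It holds without `A` being local, as is needed for Rees algebras. -/
lemma extVanishesBelow_iff_exists_isRegular [IsNoetherianRing A] [Module.Finite A X] {n : ℕ}
    (hlt : 𝔞 • (⊤ : Submodule A X) < ⊤) :
    ExtVanishesBelow 𝔞 X n ↔
      ∃ rs : List A, rs.length = n ∧ (∀ r ∈ rs, r ∈ 𝔞) ∧ IsRegular X rs := by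
  have hsupp : Module.support A (A ⧸ 𝔞) = PrimeSpectrum.zeroLocus 𝔞 := by
    rw [Module.support_eq_zeroLocus, Ideal.annihilator_quotient]
  constructor
  · intro h
    exact ModuleCat.exists_isRegular_of_exists_subsingleton_ext 𝔞 n (ModuleCat.of A X) hlt
      (ModuleCat.of A (A ⧸ 𝔞)) hsupp h
  · rintro ⟨rs, rfl, hmem, hreg⟩
    exact ModuleCat.subsingleton_ext_of_exists_isRegular 𝔞 (ModuleCat.of A (A ⧸ 𝔞)) hsupp.subset
      (ModuleCat.of A X) hlt rs hmem hreg

end ExtVanishing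

/-! ### Exact sequences of quotients -/

section QuotientSequences

variable {A X Y : Type*} [CommRing A] [AddCommGroup X] [Module A X] [AddCommGroup Y] [Module A Y]

lemma Submodule.mapQ_injective_of_comap_eq (B : Submodule A X) (B' : Submodule A Y)
    (φ : X →ₗ[A] Y) (h : B = B'.comap φ) : Function.Injective (B.mapQ B' φ h.le) := by
  rw [← LinearMap.ker_eq_bot, Submodule.ker_mapQ, ← h, Submodule.mkQ_map_self]

lemma Submodule.exact_mapQ_factor (B : Submodule A X) (B' C : Submodule A Y)
    (φ : X →ₗ[A] Y) (h : B ≤ B'.comap φ) (hC : B' ⊔ LinearMap.range φ = C) :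
    Function.Exact (B.mapQ B' φ h) (Submodule.factor (hC ▸ le_sup_left : B' ≤ C)) := by
  subst hC
  rw [LinearMap.exact_iff, Submodule.range_mapQ]
  ext y
  obtain ⟨y, rfl⟩ := B'.mkQ_surjective y
  rw [LinearMap.mem_ker, Submodule.factor_mk, Submodule.mkQ_apply, Submodule.mkQ_apply,
    Submodule.Quotient.mk_eq_zero]
  constructor
  · intro hy
    obtain ⟨b, hb, z, hz, rfl⟩ := Submodule.mem_sup.mp hy
    exact ⟨z, hz, by simpa [Submodule.Quotient.eq] using hb⟩
  · rintro ⟨z, hz, hzy⟩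
    rw [Submodule.mkQ_apply, Submodule.Quotient.eq] at hzy
    have : y = -(z - y) + z := by abel
    rw [this]
    exact add_mem (Submodule.mem_sup_left (neg_mem hzy)) (Submodule.mem_sup_right hz)

end QuotientSequences

/-! ### Graded modules over the Rees algebra inside `R[t]` -/

noncomputable section ReesModules
open Polynomial

variable {R : Type*} [CommRing R] {A : Type*} [CommRing A] [Algebra A R[X]]

variable (A) in
/-- `A`, embedded in `R[t]`, is the Rees algebra `⨁ₙ Iⁿtⁿ`. -/
structure IsReesAlgebra (I : Ideal R) : Prop where
  injective : Function.Injective (algebraMap A R[X])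
  mem_range_iff : ∀ f, f ∈ (algebraMap A R[X]).range ↔ ∀ n, f.coeff n ∈ I ^ n

namespace IsReesAlgebra

variable {I : Ideal R}

lemma coeff_mem (hA : IsReesAlgebra A I) (a : A) (n : ℕ) :
    (algebraMap A R[X] a).coeff n ∈ I ^ n :=
  (hA.mem_range_iff _).mp ⟨a, rfl⟩ n

lemma exists_eq (hA : IsReesAlgebra A I) {f : R[X]} (hf : ∀ n, f.coeff n ∈ I ^ n) :
    ∃ a : A, algebraMap A R[X] a = f :=
  (hA.mem_range_iff f).mpr hf

variable (hA : IsReesAlgebra A I)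

/-- The `A`-submodule `⨁ₙ Eₙtⁿ` of `R[t]`, for ideals with `I Eₙ ⊆ Eₙ₊₁`. -/
def submodule (E : ℕ → Ideal R) (hE : ∀ n, I * E n ≤ E (n + 1)) : Submodule A R[X] where
  carrier := {f | ∀ n, f.coeff n ∈ E n}
  zero_mem' := fun n => by simp
  add_mem' := fun {f g} hf hg n => by simpa using add_mem (hf n) (hg n)
  smul_mem' := fun c f hf n => by
    have hpow : ∀ i j, I ^ i * E j ≤ E (i + j) := by
      intro i j
      induction i with
      | zero => simp
      | succ i ih =>
        rw [pow_succ', mul_assoc, show i + 1 + j = i + j + 1 by ring]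
        exact (Ideal.mul_mono_right ih).trans (hE _)
    rw [Algebra.smul_def, coeff_mul]
    refine Ideal.sum_mem _ fun p hp => ?_
    rw [← Finset.HasAntidiagonal.mem_antidiagonal.mp hp]
    exact hpow _ _ (Ideal.mul_mem_mul (hA.coeff_mem c p.1) (hf p.2))

/-- The ideal `⨁ₙ 𝔞Iⁿtⁿ` of the Rees algebra. -/
def coeffIdeal (𝔞 : Ideal R) : Ideal A :=
  (hA.submodule (fun n => 𝔞 * I ^ n)
    (fun n => by rw [pow_succ', mul_left_comm])).comap (Algebra.linearMap A R[X])

lemma mem_coeffIdeal {𝔞 : Ideal R} {a : A} :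
    a ∈ hA.coeffIdeal 𝔞 ↔ ∀ n, (algebraMap A R[X] a).coeff n ∈ 𝔞 * I ^ n := Iff.rfl

end IsReesAlgebra

/-- The filtration `R ⊇ 𝔞 ⊇ 𝔞I ⊇ 𝔞I² ⊇ ⋯`. -/
def shiftedFiltration (𝔞 I : Ideal R) : ℕ → Ideal R
  | 0 => ⊤
  | n + 1 => 𝔞 * I ^ n

lemma mul_shiftedFiltration_le {𝔞 I : Ideal R} (h : I ≤ 𝔞) (n : ℕ) :
    I * shiftedFiltration 𝔞 I n ≤ shiftedFiltration 𝔞 I (n + 1) := by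
  cases n with
  | zero => simpa [shiftedFiltration] using h
  | succ n =>
    simp only [shiftedFiltration]
    rw [pow_succ', mul_left_comm]

lemma shiftedFiltration_succ_le (𝔞 I : Ideal R) (n : ℕ) :
    shiftedFiltration 𝔞 I (n + 1) ≤ shiftedFiltration 𝔞 I n := by
  cases n with
  | zero => exact le_top
  | succ n => exact Ideal.mul_mono_right (Ideal.pow_le_pow_right n.le_succ)

lemma pow_le_shiftedFiltration {𝔞 I : Ideal R} (h : I ≤ 𝔞) (n : ℕ) :
    I ^ n ≤ shiftedFiltration 𝔞 I n := by
  cases n with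
  | zero => exact le_top
  | succ n => rw [pow_succ']; exact Ideal.mul_mono_left h

namespace IsReesAlgebra

variable {𝔞 I : Ideal R} (hA : IsReesAlgebra A I) (h : I ≤ 𝔞)

/-- The module `R ⊕ 𝔞t ⊕ 𝔞It² ⊕ ⋯`. -/
abbrev shifted : Submodule A R[X] :=
  hA.submodule (shiftedFiltration 𝔞 I) (mul_shiftedFiltration_le h)

/-- The submodule `⨁ₙ (𝔧Fₙ₋₁ + Fₙ₊₁)tⁿ` of `⨁ₙ Fₙtⁿ`, for `F₀ = R` and `Fₙ₊₁ = 𝔞Iⁿ`. -/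
def relations (𝔧 : Ideal R) : Submodule A (hA.shifted h) :=
  (hA.submodule
    (fun n => 𝔧 * shiftedFiltration 𝔞 I (n - 1) ⊔ shiftedFiltration 𝔞 I (n + 1))
    (fun n => by
      rw [Ideal.mul_sup, mul_left_comm]
      refine sup_le_sup (Ideal.mul_mono_right ?_) (mul_shiftedFiltration_le h _)
      cases n with
      | zero => exact le_top
      | succ n => exact mul_shiftedFiltration_le h n)).comap (hA.shifted h).subtype

lemma mem_relations {𝔧 : Ideal R} {f : hA.shifted h} :
    f ∈ hA.relations h 𝔧 ↔ ∀ n, (f : R[X]).coeff n ∈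
      𝔧 * shiftedFiltration 𝔞 I (n - 1) ⊔ shiftedFiltration 𝔞 I (n + 1) := Iff.rfl

lemma mem_relations_bot {f : hA.shifted h} :
    f ∈ hA.relations h ⊥ ↔ ∀ n, (f : R[X]).coeff n ∈ 𝔞 * I ^ n := by
  simp only [mem_relations, Submodule.bot_mul, bot_sup_eq, shiftedFiltration]

/-- The inclusion of the Rees algebra into `R ⊕ 𝔞t ⊕ 𝔞It² ⊕ ⋯`. -/
def inclusion : A →ₗ[A] hA.shifted h :=
  (Algebra.linearMap A R[X]).codRestrict (hA.shifted h)
    fun a n => pow_le_shiftedFiltration h n (hA.coeff_mem a n)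

lemma mem_range_inclusion {f : hA.shifted h} :
    f ∈ LinearMap.range (hA.inclusion h) ↔ ∀ n, (f : R[X]).coeff n ∈ I ^ n := by
  constructor
  · rintro ⟨a, rfl⟩ n
    exact hA.coeff_mem a n
  · intro hf
    obtain ⟨a, ha⟩ := hA.exists_eq hf
    exact ⟨a, Subtype.ext ha⟩

/-- Multiplication by `t`, from `𝔞 ⊕ 𝔞It ⊕ ⋯` to `R ⊕ 𝔞t ⊕ 𝔞It² ⊕ ⋯`. -/
def shift : hA.coeffIdeal 𝔞 →ₗ[A] hA.shifted h where
  toFun f := ⟨X * algebraMap A R[X] f, fun n => by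
    cases n with
    | zero => trivial
    | succ n => rw [coeff_X_mul]; exact f.2 n⟩
  map_add' _ _ := Subtype.ext (by simp [mul_add])
  map_smul' _ _ := Subtype.ext (by
    simp [Algebra.smul_def, mul_left_comm])

lemma coe_shift (f : hA.coeffIdeal 𝔞) :
    (hA.shift h f : R[X]) = X * algebraMap A R[X] f := rfl

lemma coeffIdeal_eq_comap :
    hA.coeffIdeal 𝔞 = (hA.relations h ⊥).comap (hA.inclusion h) := by
  ext f
  rw [Submodule.mem_comap, mem_relations_bot]
  rfl

lemma comap_coeffIdeal_eq_comap :
    Submodule.comap (hA.coeffIdeal 𝔞).subtype (hA.coeffIdeal I) =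
      (LinearMap.range (hA.inclusion h)).comap (hA.shift h) := by
  ext f
  rw [Submodule.mem_comap, Submodule.mem_comap, mem_range_inclusion, Submodule.subtype_apply,
    mem_coeffIdeal, coe_shift]
  constructor
  · intro hf n
    cases n with
    | zero => simp
    | succ n => rw [coeff_X_mul, pow_succ']; exact hf n
  · intro hf n
    have := hf (n + 1)
    rwa [coeff_X_mul, pow_succ'] at this

/-- Dividing by `t` inverts the shift up to a constant term, and constants lie in the Rees algebra.
-/
lemma mapQ_shift_surjective :
    Function.Surjective (Submodule.mapQ _ _ (hA.shift h) (hA.comap_coeffIdeal_eq_comap h).le) := by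
  intro y
  obtain ⟨p, rfl⟩ := Submodule.mkQ_surjective _ y
  have hq : ∀ n, (divX (p : R[X])).coeff n ∈ 𝔞 * I ^ n := fun n => by
    rw [coeff_divX]; exact p.2 (n + 1)
  obtain ⟨a, ha⟩ := hA.exists_eq (fun n => Ideal.mul_le_right (hq n))
  have ha' : a ∈ hA.coeffIdeal 𝔞 := fun n => by
    rw [Algebra.linearMap_apply, ha]
    exact hq n
  refine ⟨Submodule.Quotient.mk ⟨a, ha'⟩, ?_⟩
  rw [Submodule.mapQ_apply, Submodule.mkQ_apply, Submodule.Quotient.eq, mem_range_inclusion]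
  intro n
  have : ((hA.shift h ⟨a, ha'⟩ - p : hA.shifted h) : R[X]) = C (-(p : R[X]).coeff 0) := by
    have hp := divX_mul_X_add (p : R[X])
    rw [Submodule.coe_sub, coe_shift, ha, C_neg]
    linear_combination hp
  rw [this, coeff_C]
  split_ifs with hn
  · simp [hn]
  · exact zero_mem _

/-- `𝔞A/IA ≅ (R ⊕ 𝔞t ⊕ 𝔞It² ⊕ ⋯)/A`, for the Rees algebra `A` of `I`. -/
def shiftEquiv :
    (hA.coeffIdeal 𝔞 ⧸ Submodule.comap (hA.coeffIdeal 𝔞).subtype (hA.coeffIdeal I))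
      ≃ₗ[A] (hA.shifted h ⧸ LinearMap.range (hA.inclusion h)) :=
  LinearEquiv.ofBijective _
    ⟨Submodule.mapQ_injective_of_comap_eq _ _ _ (hA.comap_coeffIdeal_eq_comap h),
      hA.mapQ_shift_surjective h⟩

lemma relations_bot_sup_range :
    hA.relations h ⊥ ⊔ LinearMap.range (hA.inclusion h) = LinearMap.range (hA.inclusion h) := by
  refine sup_eq_right.mpr fun f hf => ?_
  rw [mem_relations_bot] at hf
  rw [mem_range_inclusion]
  exact fun n => Ideal.mul_le_right (hf n)

include h in
lemma coeffIdeal_sup_range : hA.coeffIdeal I ⊔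
    LinearMap.range (hA.coeffIdeal 𝔞).subtype = hA.coeffIdeal 𝔞 := by
  rw [Submodule.range_subtype, sup_eq_right]
  exact fun f hf n => Ideal.mul_mono_left h (hf n)

include hA in
lemma exists_monomial_one {a : R} (ha : a ∈ I) :
    ∃ b : A, algebraMap A R[X] b = monomial 1 a :=
  hA.exists_eq fun n => by
    rw [coeff_monomial]
    split_ifs with hn
    · simpa [← hn] using ha
    · exact zero_mem _

variable {a : R} {b : A} (hb : algebraMap A R[X] b = monomial 1 a)
include hb

lemma coeff_smul_zero (f : hA.shifted h) : ((b • f : hA.shifted h) : R[X]).coeff 0 = 0 := by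
  rw [Submodule.coe_smul, Algebra.smul_def, hb]
  simp [mul_coeff_zero]

lemma coeff_smul_succ (f : hA.shifted h) (n : ℕ) :
    ((b • f : hA.shifted h) : R[X]).coeff (n + 1) = a * (f : R[X]).coeff n := by
  rw [Submodule.coe_smul, Algebra.smul_def, hb]
  simpa using coeff_monomial_mul (f : R[X]) 1 n a

/-- Killing `at` on the quotient attached to `𝔟` gives the quotient attached to `𝔟 + (a)`, which
lets the regular sequence be processed one element at a time. The inclusion `≥` is checked on
monomials. -/
lemma relations_sup_range (𝔟 : Ideal R) :
    hA.relations h 𝔟 ⊔ LinearMap.range (LinearMap.lsmul A (hA.shifted h) b) =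
      hA.relations h (𝔟 ⊔ Ideal.span {a}) := by
  apply le_antisymm
  · refine sup_le ?_ ?_
    · intro f hf n
      have hle : 𝔟 ≤ 𝔟 ⊔ Ideal.span {a} := le_sup_left
      exact sup_le_sup (Ideal.mul_mono_left hle) le_rfl (hf n)
    · rintro _ ⟨f, rfl⟩
      rw [mem_relations]
      intro n
      rw [LinearMap.lsmul_apply]
      cases n with
      | zero => rw [hA.coeff_smul_zero h hb]; exact zero_mem _
      | succ n =>
        rw [hA.coeff_smul_succ h hb]
        exact Submodule.mem_sup_left (Ideal.mul_mem_mul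
          (Ideal.mem_sup_right (Ideal.mem_span_singleton_self _)) (f.2 n))
  · intro f hf
    rw [mem_relations] at hf
    have hmem : ∀ n, ∀ r ∈ shiftedFiltration 𝔞 I n, monomial n r ∈ hA.shifted h := by
      intro n r hr k
      rw [coeff_monomial]
      split_ifs with hk
      · exact hk ▸ hr
      · exact zero_mem _
    have hrel : ∀ n r, ∀ hr : r ∈ shiftedFiltration 𝔞 I n,
        r ∈ 𝔟 * shiftedFiltration 𝔞 I (n - 1) ⊔ shiftedFiltration 𝔞 I (n + 1) →
          (⟨monomial n r, hmem n r hr⟩ : hA.shifted h) ∈ hA.relations h 𝔟 := by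
      intro n r hr hr' k
      simp only [Submodule.subtype_apply]
      rw [coeff_monomial]
      split_ifs with hk
      · exact hk ▸ hr'
      · exact zero_mem _
    have key : ∀ n r, ∀ hr : r ∈ shiftedFiltration 𝔞 I n,
        r ∈ (𝔟 ⊔ Ideal.span {a}) * shiftedFiltration 𝔞 I (n - 1) ⊔ shiftedFiltration 𝔞 I (n + 1) →
          (⟨monomial n r, hmem n r hr⟩ : hA.shifted h) ∈ hA.relations h 𝔟 ⊔
            LinearMap.range (LinearMap.lsmul A (hA.shifted h) b) := by
      intro n r hr hn
      cases n with
      -- Here `n - 1` truncates to `0`, so the relations contain a spurious `(a)`; it is absorbed by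
      -- `𝔞`, since `a ∈ I ⊆ 𝔞`.
      | zero =>
        have ha : Ideal.span {a} ≤ 𝔞 := by
          rw [Ideal.span_singleton_le_iff_mem]
          have := hA.coeff_mem b 1
          rw [hb, coeff_monomial_same, pow_one] at this
          exact h this
        refine Submodule.mem_sup_left (hrel _ _ hr ?_)
        simp only [zero_tsub, shiftedFiltration, Ideal.mul_top, pow_zero,
          Ideal.one_eq_top] at hn ⊢
        rwa [sup_assoc, sup_eq_right.mpr ha] at hn
      | succ n =>
        rw [Ideal.sup_mul, sup_assoc, sup_comm (Ideal.span {a} * _), ← sup_assoc] at hn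
        obtain ⟨u, hu, e, he, hue⟩ := Submodule.mem_sup.mp hn
        obtain ⟨c, hc, rfl⟩ := Ideal.mem_span_singleton_mul.mp he
        have haI : a ∈ I := by
          have := hA.coeff_mem b 1
          rwa [hb, coeff_monomial_same, pow_one] at this
        have hac : a * c ∈ shiftedFiltration 𝔞 I (n + 1) :=
          mul_shiftedFiltration_le h n (Ideal.mul_mem_mul haI hc)
        have hu' : u ∈ shiftedFiltration 𝔞 I (n + 1) := by
          rw [eq_sub_of_add_eq hue]
          exact sub_mem hr hac
        have hsplit : (⟨monomial (n + 1) r, hmem _ r hr⟩ : hA.shifted h) =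
            ⟨monomial (n + 1) u, hmem _ u hu'⟩ +
              b • (⟨monomial n c, hmem n c hc⟩ : hA.shifted h) := by
          apply Subtype.ext
          rw [Submodule.coe_add, Submodule.coe_smul, Algebra.smul_def, hb,
            monomial_mul_monomial, add_comm 1 n]
          exact (congrArg _ hue.symm).trans (map_add _ _ _)
        rw [hsplit]
        exact add_mem (Submodule.mem_sup_left (hrel _ _ hu' hu))
          (Submodule.mem_sup_right ⟨_, rfl⟩)
    have hfsum : f = ∑ n ∈ (f : R[X]).support,
        ⟨monomial n ((f : R[X]).coeff n), hmem n _ (f.2 n)⟩ := by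
      apply Subtype.ext
      rw [AddSubmonoidClass.coe_finsetSum]
      exact (f : R[X]).as_sum_support
    rw [hfsum]
    exact Submodule.sum_mem _ fun n _ => key n _ (f.2 n) (hf n)

end IsReesAlgebra
end ReesModules

/-! ### Regular sequences and the Valabrega–Valla argument -/

section RegularChains

variable {R : Type*} [CommRing R]

/-- A chain `0 = 𝔧₀ ⊆ 𝔧₁ ⊆ ⋯ ⊆ 𝔧_d = J` in which `𝔧ᵢ₊₁` is generated over `𝔧ᵢ` by an element that
is regular modulo `𝔧ᵢ`. -/
structure IsRegularChain (x : ℕ → R) (𝔧 : ℕ → Ideal R) (d : ℕ) (J : Ideal R) : Prop where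
  zero : 𝔧 0 = ⊥
  succ : ∀ i < d, 𝔧 (i + 1) = 𝔧 i ⊔ Ideal.span {x i}
  top : 𝔧 d = J
  regular : ∀ i < d, ∀ y, x i * y ∈ 𝔧 i → y ∈ 𝔧 i

variable {x : ℕ → R} {𝔧 : ℕ → Ideal R} {d : ℕ} {J : Ideal R}

namespace IsRegularChain

lemma le_succ (hc : IsRegularChain x 𝔧 d J) {i : ℕ} (hi : i < d) : 𝔧 i ≤ 𝔧 (i + 1) := by
  rw [hc.succ i hi]
  exact le_sup_left

lemma mem_succ (hc : IsRegularChain x 𝔧 d J) {i : ℕ} (hi : i < d) : x i ∈ 𝔧 (i + 1) := by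
  rw [hc.succ i hi]
  exact Ideal.mem_sup_right (Ideal.mem_span_singleton_self _)

lemma le (hc : IsRegularChain x 𝔧 d J) {i : ℕ} (hi : i ≤ d) : 𝔧 i ≤ J := by
  induction hi using Nat.decreasingInduction with
  | self => exact hc.top.le
  | of_succ i hi ih => exact (hc.le_succ hi).trans ih

lemma mem (hc : IsRegularChain x 𝔧 d J) {i : ℕ} (hi : i < d) : x i ∈ J :=
  hc.le (Nat.succ_le_of_lt hi) (hc.mem_succ hi)

/-- The descent step in the theorem of Valabrega and Valla: if `J ∩ Fₙ₊₁ = JFₙ` for all `n`, then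
the same holds for the partial ideals `𝔧ᵢ`. -/
lemma inf_le (hc : IsRegularChain x 𝔧 d J)
    {F : ℕ → Ideal R} (hF0 : F 0 = ⊤) (hF : ∀ n, J * F n ≤ F (n + 1))
    (hJF : ∀ n, J ⊓ F (n + 1) ≤ J * F n) {i : ℕ} (hi : i ≤ d) (n : ℕ) :
    𝔧 i ⊓ F (n + 1) ≤ 𝔧 i * F n := by
  induction hi using Nat.decreasingInduction generalizing n with
  | self => simpa [hc.top] using hJF n
  | of_succ i hi ih =>
    induction n with
    | zero => simp [hF0]
    | succ n ihn =>
      rintro a ⟨ha, haF⟩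
      -- The outer hypothesis writes the element as `b + xᵢc` with `b ∈ 𝔧ᵢFₙ₊₁` and `c ∈ Fₙ₊₁`.
      -- Regularity puts `c` in `𝔧ᵢ`, the inner hypothesis puts it in `𝔧ᵢFₙ`, and `xᵢFₙ ⊆ Fₙ₊₁`.
      have h1 := ih (n + 1) ⟨hc.le_succ hi ha, haF⟩
      rw [hc.succ i hi, Ideal.sup_mul] at h1
      obtain ⟨b, hb, e, he, rfl⟩ := Submodule.mem_sup.mp h1
      obtain ⟨c, hc', rfl⟩ := Ideal.mem_span_singleton_mul.mp he
      have hbj : b ∈ 𝔧 i := Ideal.mul_le_left hb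
      have hcj : c ∈ 𝔧 i := by
        refine hc.regular i hi c ?_
        have := sub_mem ha hbj
        rwa [add_sub_cancel_left] at this
      have h2 := ihn ⟨hcj, hc'⟩
      refine add_mem hb ?_
      have h3 : x i * c ∈ J * (𝔧 i * F n) := Ideal.mul_mem_mul (hc.mem hi) h2
      rw [mul_left_comm] at h3
      exact Ideal.mul_mono_right (hF n) h3

end IsRegularChain

open Polynomial

variable {A : Type*} [CommRing A] [Algebra A R[X]] {𝔞 I : Ideal R} (hA : IsReesAlgebra A I)
  (h : I ≤ 𝔞)

/-- Suppose `xᵢfₙ = u + e` with `u ∈ 𝔧ᵢFₙ` and `e ∈ Fₙ₊₂`. Then `e ∈ 𝔧ᵢ₊₁`, so `inf_le` gives `e =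
u' + xᵢc` with `u' ∈ 𝔧ᵢ` and `c ∈ Fₙ₊₁`. Regularity modulo `𝔧ᵢ` gives `fₙ - c ∈ 𝔧ᵢ ∩ Fₙ`, and
`inf_le` applies again. -/
lemma IsReesAlgebra.isSMulRegular_of_isRegularChain (hc : IsRegularChain x 𝔧 d J) (hJI : J ≤ I)
    (hJF : ∀ n, J ⊓ 𝔞 * I ^ n ≤ J * shiftedFiltration 𝔞 I n) {i : ℕ} (hi : i < d)
    {b : A} (hb : algebraMap A R[X] b = monomial 1 (x i)) :
    IsSMulRegular (hA.shifted h ⧸ hA.relations h (𝔧 i)) b := by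
  have hF : ∀ n, J * shiftedFiltration 𝔞 I n ≤ shiftedFiltration 𝔞 I (n + 1) := fun n =>
    (Ideal.mul_mono_left hJI).trans (mul_shiftedFiltration_le h n)
  have hle : ∀ {k : ℕ}, k ≤ d → ∀ n,
      𝔧 k ⊓ shiftedFiltration 𝔞 I (n + 1) ≤ 𝔧 k * shiftedFiltration 𝔞 I n :=
    fun hk n => hc.inf_le rfl hF hJF hk n
  rw [isSMulRegular_iff_right_eq_zero_of_smul]
  intro y hy
  obtain ⟨f, rfl⟩ := Submodule.mkQ_surjective _ y
  rw [← map_smul, Submodule.mkQ_apply, Submodule.Quotient.mk_eq_zero, hA.mem_relations] at hy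
  rw [Submodule.mkQ_apply, Submodule.Quotient.mk_eq_zero, hA.mem_relations]
  intro n
  have h1 := hy (n + 1)
  rw [hA.coeff_smul_succ h hb] at h1
  obtain ⟨u, hu, e, he, hue⟩ := Submodule.mem_sup.mp h1
  have huj : u ∈ 𝔧 i := Ideal.mul_le_left hu
  have he2 : e ∈ 𝔧 (i + 1) := by
    rw [eq_sub_of_add_eq' hue]
    exact sub_mem (Ideal.mul_mem_right _ _ (hc.mem_succ hi)) (hc.le_succ hi huj)
  have he3 := hle (Nat.succ_le_of_lt hi) (n + 1) ⟨he2, he⟩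
  rw [hc.succ i hi, Ideal.sup_mul] at he3
  obtain ⟨u', hu', e', he', rfl⟩ := Submodule.mem_sup.mp he3
  obtain ⟨c, hcF, rfl⟩ := Ideal.mem_span_singleton_mul.mp he'
  have huj' : u' ∈ 𝔧 i := Ideal.mul_le_left hu'
  have hdiff : (f : R[X]).coeff n - c ∈ 𝔧 i := by
    refine hc.regular i hi _ ?_
    have : x i * ((f : R[X]).coeff n - c) = u + u' := by rw [mul_sub, ← hue]; ring
    rw [this]
    exact add_mem huj huj'
  rw [← sub_add_cancel ((f : R[X]).coeff n) c]
  refine add_mem (Submodule.mem_sup_left ?_) (Submodule.mem_sup_right hcF)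
  cases n with
  | zero => simpa [shiftedFiltration] using hdiff
  | succ n =>
    exact hle hi.le n
      ⟨hdiff, sub_mem (f.2 (n + 1)) (shiftedFiltration_succ_le 𝔞 I _ hcF)⟩

end RegularChains

/-! ### From the intersection condition to Ext vanishing -/

section ReesExt
universe u
open Polynomial

variable {R A : Type u} [CommRing R] [CommRing A] [Algebra A R[X]] {𝔞 I : Ideal R}
  (hA : IsReesAlgebra A I) (h : I ≤ 𝔞)

include h in
-- The middle term of both sequences is `𝔞A/IA`, with `shiftEquiv` identifying it with the cokernel
-- of the inclusion. The modules carry no grading here, so the degree shift is invisible to Ext.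
lemma IsReesAlgebra.extVanishesBelow_quotient (𝔐 : Ideal A) {s : ℕ}
    (hL : ExtVanishesBelow 𝔐 (hA.shifted h ⧸ hA.relations h ⊥) (s + 1))
    (hG : ExtVanishesBelow 𝔐 (A ⧸ hA.coeffIdeal I) s) :
    ExtVanishesBelow 𝔐 (A ⧸ hA.coeffIdeal 𝔞) (s + 1) := by
  refine ExtVanishesBelow.of_exact_of_exact
    (f := Submodule.mapQ _ _ (hA.inclusion h) (hA.coeffIdeal_eq_comap h).le)
    (g := (hA.shiftEquiv h).symm.toLinearMap ∘ₗ
      Submodule.factor (hA.relations_bot_sup_range h ▸ le_sup_left))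
    (f' := Submodule.mapQ _ (hA.coeffIdeal I) (hA.coeffIdeal 𝔞).subtype le_rfl)
    (g' := Submodule.factor ((hA.coeffIdeal_sup_range h) ▸ le_sup_left))
    ?_ ?_ ?_ ?_ ?_ ?_ hL hG
  · exact Submodule.mapQ_injective_of_comap_eq _ _ _ (hA.coeffIdeal_eq_comap h)
  · exact (hA.shiftEquiv h).symm.surjective.comp (Submodule.factor_surjective _)
  · intro y
    rw [LinearMap.comp_apply, LinearEquiv.coe_coe, LinearEquiv.map_eq_zero_iff]
    exact Submodule.exact_mapQ_factor _ _ _ _ (hA.coeffIdeal_eq_comap h).le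
      (hA.relations_bot_sup_range h) y
  · exact Submodule.mapQ_injective_of_comap_eq _ _ _ rfl
  · exact Submodule.factor_surjective _
  · exact Submodule.exact_mapQ_factor _ _ _ _ le_rfl (hA.coeffIdeal_sup_range h)

variable {x : ℕ → R} {𝔧 : ℕ → Ideal R} {d : ℕ} {J : Ideal R}

/-- Descending induction along the chain: the bound is vacuous at `i = d`, and each regular `xᵢt ∈
𝔐` raises it by one. -/
lemma IsReesAlgebra.extVanishesBelow_shifted (𝔐 : Ideal A)
    (h𝔐 : ∀ a, (algebraMap A R[X] a).coeff 0 = 0 → a ∈ 𝔐)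
    (hc : IsRegularChain x 𝔧 d J) (hJI : J ≤ I)
    (hJF : ∀ n, J ⊓ 𝔞 * I ^ n ≤ J * shiftedFiltration 𝔞 I n) :
    ExtVanishesBelow 𝔐 (hA.shifted h ⧸ hA.relations h ⊥) d := by
  suffices H : ∀ i ≤ d, ExtVanishesBelow 𝔐 (hA.shifted h ⧸ hA.relations h (𝔧 i)) (d - i) by
    have := H 0 d.zero_le
    rwa [hc.zero] at this
  intro i hi
  induction hi using Nat.decreasingInduction with
  | self => intro j hj; omega
  | of_succ i hi ih =>
    obtain ⟨b, hb⟩ := hA.exists_monomial_one (hJI (hc.mem hi))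
    have hrange := hA.relations_sup_range h hb (𝔧 i)
    rw [← hc.succ i hi] at hrange
    have hle : hA.relations h (𝔧 i) ≤ (hA.relations h (𝔧 i)).comap
      (LinearMap.lsmul A (hA.shifted h) b) := fun f hf => Submodule.smul_mem _ _ hf
    have hex := Submodule.exact_mapQ_factor _ _ _ _ hle hrange
    have hmap : Submodule.mapQ _ _ _ hle =
        LinearMap.lsmul A (hA.shifted h ⧸ hA.relations h (𝔧 i)) b := by
      ext
      rfl
    rw [hmap] at hex
    rw [show d - i = d - (i + 1) + 1 by omega]
    refine ExtVanishesBelow.succ_of_exact_smul (h𝔐 b ?_)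
      (hA.isSMulRegular_of_isRegularChain h hc hJI hJF hi hb) _
      (Submodule.factor_surjective _) hex ih
    rw [hb, coeff_monomial]
    simp

end ReesExt

/-! ### Minimal reductions and analytic independence -/

section MinimalReductions
open MvPolynomial

variable {R : Type*} [CommRing R]

lemma prod_pow_mem_pow {ι : Type*} {J : Ideal R} {x : ι → R} (hx : ∀ i, x i ∈ J) (s : ι →₀ ℕ) :
    (s.prod fun i k => x i ^ k) ∈ J ^ s.degree := by
  classical
  induction s using Finsupp.induction_linear with
  | zero => simp
  | add s t hs ht =>
    rw [Finsupp.prod_add_index' (by simp) (by simp [pow_add]), map_add, pow_add]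
    exact Ideal.mul_mem_mul hs ht
  | single i k =>
    rw [Finsupp.prod_single_index (by simp), Finsupp.degree_single]
    exact Ideal.pow_mem_pow (hx i) k

lemma exists_eq_single_add_of_degree_eq_succ {ι : Type*} {s : ι →₀ ℕ} {m : ℕ}
    (hs : s.degree = m + 1) : ∃ i t, s = Finsupp.single i 1 + t ∧ t.degree = m := by
  have hne : s ≠ 0 := by rintro rfl; simp at hs
  obtain ⟨i, hi⟩ := Finsupp.ne_iff.mp hne
  have hadd : Finsupp.single i 1 + (s - Finsupp.single i 1) = s := by
    refine add_tsub_cancel_of_le ?_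
    rw [Finsupp.single_le_iff]
    exact Nat.one_le_iff_ne_zero.mpr hi
  refine ⟨i, s - Finsupp.single i 1, hadd.symm, ?_⟩
  have := congrArg Finsupp.degree hadd
  rw [map_add, Finsupp.degree_single] at this
  omega

/-- Monomials of degree `m` in two families from `J` that agree modulo `K ⊆ J` agree modulo
`KJᵐ⁻¹`. -/
lemma prod_pow_sub_prod_pow_mem {ι : Type*} {J K : Ideal R} {x y : ι → R} (hx : ∀ i, x i ∈ J)
    (hy : ∀ i, y i ∈ J) (hxy : ∀ i, x i - y i ∈ K) {m : ℕ} (s : ι →₀ ℕ)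
    (hs : s.degree = m + 1) :
    (s.prod fun i k => x i ^ k) - (s.prod fun i k => y i ^ k) ∈ K * J ^ m := by
  classical
  induction m generalizing s with
  | zero =>
    obtain ⟨i, t, rfl, ht⟩ := exists_eq_single_add_of_degree_eq_succ hs
    obtain rfl := (Finsupp.degree_eq_zero_iff t).mp ht
    simpa [Finsupp.prod_single_index] using hxy i
  | succ m ih =>
    obtain ⟨i, t, rfl, ht⟩ := exists_eq_single_add_of_degree_eq_succ hs
    simp only [Finsupp.prod_add_index' (h := fun i k => x i ^ k) (by simp) (by simp [pow_add]),
      Finsupp.prod_add_index' (h := fun i k => y i ^ k) (by simp) (by simp [pow_add])]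
    rw [Finsupp.prod_single_index (by simp), Finsupp.prod_single_index (by simp), pow_one, pow_one]
    have hsplit : ∀ a b c d : R, a * b - c * d = (a - c) * b + c * (b - d) := by intros; ring
    rw [hsplit]
    refine add_mem (Ideal.mul_mem_mul (hxy i) (ht ▸ prod_pow_mem_pow hx t)) ?_
    have := Ideal.mul_mem_mul (hy i) (ih t ht)
    rwa [mul_left_comm, ← pow_succ'] at this

lemma sup_span_singleton_pow_succ_le (K : Ideal R) (u : R) (m : ℕ) :
    (K ⊔ Ideal.span {u}) ^ (m + 1) ≤
      K * (K ⊔ Ideal.span {u}) ^ m ⊔ Ideal.span {u ^ (m + 1)} := by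
  induction m with
  | zero => simp
  | succ m ih =>
    set J := K ⊔ Ideal.span {u}
    calc J ^ (m + 1 + 1) = J * J ^ (m + 1) := pow_succ' _ _
      _ ≤ J * (K * J ^ m ⊔ Ideal.span {u ^ (m + 1)}) := Ideal.mul_mono_right ih
      _ = K * J ^ (m + 1) ⊔ (K * Ideal.span {u ^ (m + 1)} ⊔ Ideal.span {u ^ (m + 1 + 1)}) := by
        rw [Ideal.mul_sup, mul_left_comm, ← pow_succ', Ideal.sup_mul K,
          Ideal.span_singleton_mul_span_singleton, ← pow_succ']
      _ ≤ K * J ^ (m + 1) ⊔ Ideal.span {u ^ (m + 1 + 1)} := by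
        refine sup_le le_sup_left (sup_le (le_sup_of_le_left (Ideal.mul_mono_right ?_)) le_sup_right)
        rw [← Ideal.span_singleton_pow]
        exact Ideal.pow_right_mono le_sup_right _

/-- Supplies the contradiction whenever a member of a minimal generating family turns out to be
superfluous. -/
lemma spanFinrank_span_image_erase_lt {ι : Type*} [Fintype ι] (x : ι → R) (i : ι) :
    (Submodule.span R (x '' {j | j ≠ i})).spanFinrank < Fintype.card ι := by
  classical
  refine (Submodule.spanFinrank_span_le_ncard_of_finite (Set.toFinite _)).trans_lt
    ((Set.ncard_image_le (Set.toFinite _)).trans_lt ?_)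
  rw [← Nat.card_eq_fintype_card, ← Set.ncard_univ]
  exact Set.ncard_lt_ncard ((Set.ssubset_univ_iff).mpr fun h =>
    (h ▸ Set.mem_univ i : i ∈ {j | j ≠ i}) rfl)

lemma isReductionWrt_self_iff {I K : Ideal R} :
    IsReductionWrt R I K ↔ K ≤ I ∧ ∃ n : ℕ, I ^ (n + 1) = K * I ^ n := by
  simp [IsReductionWrt]

lemma pow_add_eq_of_pow_succ_eq {I J : Ideal R} {n : ℕ} (h : I ^ (n + 1) = J * I ^ n) (m : ℕ) :
    I ^ (n + m) = J ^ m * I ^ n := by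
  induction m with
  | zero => simp
  | succ m ih =>
    rw [← add_assoc, pow_succ' I, ih, mul_left_comm, ← pow_succ', h, pow_succ, mul_assoc]

section Local
variable [IsLocalRing R] [IsNoetherianRing R] {I J : Ideal R}

lemma le_of_le_sup_maximalIdeal_mul {K L : Ideal R} (h : L ≤ K ⊔ maximalIdeal R * L) : L ≤ K :=
  Submodule.le_of_le_smul_of_le_jacobson_bot (IsNoetherian.noetherian L)
    (maximalIdeal_le_jacobson _) h

/-- A subideal of a minimal reduction that generates one of its powers as a reduction is
everything. -/
lemma IsMinimalReduction.eq_of_pow_succ_le (hJ : IsMinimalReduction I J) {K : Ideal R} (hK : K ≤ J)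
    {m : ℕ} (h : J ^ (m + 1) ≤ K * J ^ m ⊔ maximalIdeal R * J ^ (m + 1)) : K = J := by
  have hred := isReductionWrt_self_iff.mp hJ.prop
  obtain ⟨n, hn⟩ := hred.2
  -- By Nakayama `Jᵐ⁺¹ ⊆ KJᵐ`, so `Iⁿ⁺ᵐ⁺¹ = Jᵐ⁺¹Iⁿ ⊆ KJᵐIⁿ = KIⁿ⁺ᵐ` and `K` is a reduction of `I`.
  have h' := le_of_le_sup_maximalIdeal_mul h
  refine hJ.eq_of_le (isReductionWrt_self_iff.mpr ⟨hK.trans hred.1, n + m, le_antisymm ?_ ?_⟩) hK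
  · rw [add_assoc, pow_add_eq_of_pow_succ_eq hn, pow_add_eq_of_pow_succ_eq hn, ← mul_assoc]
    exact Ideal.mul_mono_left h'
  · rw [pow_succ']
    exact Ideal.mul_mono_left (hK.trans hred.1)

/-- Multiplying by `Iⁿ` gives `Iⁿ⁺¹ ⊆ KIⁿ + 𝔪Iⁿ⁺¹`, so by Nakayama `K` is already a reduction. -/
lemma IsMinimalReduction.eq_of_le_sup (hJ : IsMinimalReduction I J) {K : Ideal R} (hK : K ≤ J)
    (h : J ≤ K ⊔ maximalIdeal R * I) : K = J := by
  have hred := isReductionWrt_self_iff.mp hJ.prop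
  obtain ⟨n, hn⟩ := hred.2
  refine hJ.eq_of_le (isReductionWrt_self_iff.mpr ⟨hK.trans hred.1, n, le_antisymm ?_ ?_⟩) hK
  · refine le_of_le_sup_maximalIdeal_mul ?_
    conv_lhs => rw [hn]
    refine (Ideal.mul_mono_left h).trans ?_
    rw [Ideal.sup_mul, mul_assoc, ← pow_succ']
  · rw [pow_succ']
    exact Ideal.mul_mono_left (hK.trans hred.1)

variable {ι : Type*} [Fintype ι] {x : ι → R}

/-- A minimal reduction satisfies `J ∩ 𝔪I = 𝔪J`. -/
lemma IsMinimalReduction.inf_maximalIdeal_mul_le (hJ : IsMinimalReduction I J) :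
    J ⊓ maximalIdeal R * I ≤ maximalIdeal R * J := by
  classical
  obtain ⟨T, hT, hspan⟩ :=
    (IsNoetherian.noetherian J).exists_span_finset_card_eq_spanFinrank
  rintro a ⟨haJ, haI⟩
  rw [SetLike.mem_coe, ← hspan] at haJ
  obtain ⟨r, -, rfl⟩ := Submodule.mem_span_finset.mp haJ
  have hTJ : ∀ t ∈ T, t ∈ J := fun t ht => hspan ▸ Submodule.subset_span ht
  refine sum_mem fun t ht => Ideal.mul_mem_mul ?_ (hTJ t ht)
  -- If the coefficient of `t` were a unit, the other generators would generate `J` modulo `𝔪I`,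
  -- hence all of `J`.
  by_contra hr
  rw [mem_maximalIdeal, mem_nonunits_iff, not_not] at hr
  have hlt := spanFinrank_span_image_erase_lt (fun t : T => (t : R)) ⟨t, ht⟩
  rw [Fintype.card_coe, hT] at hlt
  refine hlt.ne (congrArg _ (hJ.eq_of_le_sup ?_ ?_))
  · rw [Submodule.span_le]
    rintro _ ⟨s, -, rfl⟩
    exact hTJ s s.2
  · set K : Ideal R := Submodule.span R ((fun t : T => (t : R)) '' {j | j ≠ ⟨t, ht⟩}) with hKdef
    have hmem : ∀ s ∈ T, s ≠ t → s ∈ K := fun s hs hst =>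
      Submodule.subset_span ⟨⟨s, hs⟩, by simpa using hst, rfl⟩
    conv_lhs => rw [← hspan]
    rw [Submodule.span_le]
    intro s hs
    by_cases hst : s = t
    · subst hst
      rw [SetLike.mem_coe]
      refine (Ideal.unit_mul_mem_iff_mem _ hr).mp ?_
      rw [← Finset.add_sum_erase T _ hs] at haI
      rw [← add_sub_cancel_right (r s * s) (∑ t ∈ T.erase s, r t • t)]
      refine sub_mem (Submodule.mem_sup_right haI) (Submodule.mem_sup_left (sum_mem fun t ht => ?_))
      exact Ideal.mul_mem_left _ _ (hmem t (Finset.mem_of_mem_erase ht) (Finset.ne_of_mem_erase ht))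
    · exact Submodule.mem_sup_left (hmem s hs hst)

/-- Minimal generators of a minimal reduction are analytically independent. -/
lemma IsMinimalReduction.coeff_mem_maximalIdeal [Infinite (ResidueField R)]
    (hJ : IsMinimalReduction I J) (hx : Ideal.span (Set.range x) = J)
    (hcard : Fintype.card ι = J.spanFinrank) {m : ℕ} {f : MvPolynomial ι R}
    (hf : ∀ s ∈ f.support, s.degree = m) (hfx : eval x f ∈ maximalIdeal R * J ^ m)
    (s : ι →₀ ℕ) : coeff s f ∈ maximalIdeal R := by
  classical
  have hxJ : ∀ i, x i ∈ J := fun i => hx ▸ Ideal.subset_span ⟨i, rfl⟩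
  by_contra hs
  have hf0 : map (residue R) f ≠ 0 := by
    intro h0
    have := congrArg (coeff s) h0
    rw [coeff_map, coeff_zero, residue_eq_zero_iff] at this
    exact hs this
  -- Over an infinite field a nonzero polynomial has a nonzero value; lifting the point makes `f(c)`
  -- a unit.
  obtain ⟨c', hc'⟩ : ∃ c' : ι → ResidueField R, eval c' (map (residue R) f) ≠ 0 := by
    by_contra! h0
    exact hf0 (MvPolynomial.funext fun c => by simpa using h0 c)
  choose c hc using fun i => residue_surjective (c' i)
  have hunit : IsUnit (eval c f) := by
    by_contra hnu
    have : residue R (eval c f) = 0 := (residue_eq_zero_iff _).mpr hnu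
    rw [← eval₂_id, hom_eval₂, RingHom.comp_id] at this
    rw [eval_map] at hc'
    exact hc' (by simpa [Function.comp_def, hc] using this)
  cases m with
  | zero =>
    have hfC : f = C (coeff 0 f) := by
      ext t
      rw [coeff_C]
      split_ifs with ht
      · rw [ht]
      · by_contra hne
        exact ht ((Finsupp.degree_eq_zero_iff t).mp (hf t (mem_support_iff.mpr hne))).symm
    rw [hfC] at hfx hunit
    rw [eval_C] at hfx hunit
    rw [pow_zero, mul_one] at hfx
    exact hfx hunit
  | succ m =>
    obtain ⟨i, hi⟩ : ∃ i, IsUnit (c i) := by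
      by_contra! hni
      refine (mem_maximalIdeal _).mp ?_ hunit
      rw [eval_eq]
      refine sum_mem fun t ht => Ideal.mul_mem_left _ _ ?_
      have hmem := prod_pow_mem_pow (J := maximalIdeal R) (x := c) (fun i => hni i) t
      rw [hf t ht] at hmem
      exact Ideal.pow_le_self m.succ_ne_zero hmem
    -- With `u = cᵢ⁻¹xᵢ` and `K` generated by the `xⱼ - cⱼu` for `j ≠ i`, homogeneity gives `f(x) ≡
    -- f(c)uᵐ⁺¹` modulo `KJᵐ`. As `f(c)` is a unit, `uᵐ⁺¹`, and with it `Jᵐ⁺¹`, lies in `KJᵐ +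
    -- 𝔪Jᵐ⁺¹`. Then `K = J`, with one generator too few.
    obtain ⟨e, he⟩ := hi.exists_right_inv
    set u := e * x i with hu
    have huJ : u ∈ J := Ideal.mul_mem_left _ _ (hxJ i)
    set K : Ideal R := Submodule.span R ((fun j => x j - c j * u) '' {j | j ≠ i}) with hKdef
    have hxK : ∀ j, x j - c j * u ∈ K := by
      intro j
      by_cases hj : j = i
      · have : x j - c j * u = 0 := by rw [hj, hu, ← mul_assoc, he, one_mul, sub_self]
        rw [this]
        exact zero_mem _
      · exact Submodule.subset_span ⟨j, hj, rfl⟩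
    have hKJ : K ≤ J := by
      rw [hKdef, Submodule.span_le]
      rintro _ ⟨j, -, rfl⟩
      exact sub_mem (hxJ j) (Ideal.mul_mem_left _ _ huJ)
    have hsup : K ⊔ Ideal.span {u} = J := by
      refine le_antisymm (sup_le hKJ ((Ideal.span_singleton_le_iff_mem _).mpr huJ)) ?_
      rw [← hx, Ideal.span_le]
      rintro _ ⟨j, rfl⟩
      rw [SetLike.mem_coe, ← sub_add_cancel (x j) (c j * u)]
      exact add_mem (Submodule.mem_sup_left (hxK j)) (Submodule.mem_sup_right
        (Ideal.mul_mem_left _ _ (Ideal.mem_span_singleton_self u)))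
    have hdiff : eval x f - eval c f * u ^ (m + 1) ∈ K * J ^ m := by
      rw [eval_eq, eval_eq, Finset.sum_mul, ← Finset.sum_sub_distrib]
      refine sum_mem fun t ht => ?_
      have hpow : u ^ (m + 1) = ∏ j ∈ t.support, u ^ t j := by
        rw [Finset.prod_pow_eq_pow_sum, ← hf t ht]
        rfl
      rw [mul_assoc, ← mul_sub, hpow, ← Finset.prod_mul_distrib]
      simp only [← mul_pow]
      exact Ideal.mul_mem_left _ _ (prod_pow_sub_prod_pow_mem hxJ
        (fun j => Ideal.mul_mem_left _ (c j) huJ) hxK t (hf t ht))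
    have hum : u ^ (m + 1) ∈ K * J ^ m ⊔ maximalIdeal R * J ^ (m + 1) := by
      refine (Ideal.unit_mul_mem_iff_mem _ hunit).mp ?_
      rw [← sub_sub_cancel (eval x f) (eval c f * u ^ (m + 1))]
      exact sub_mem (Submodule.mem_sup_right hfx) (Submodule.mem_sup_left hdiff)
    have hKeq : K = J := by
      refine hJ.eq_of_pow_succ_le hKJ (m := m) ?_
      have h1 := sup_span_singleton_pow_succ_le K u m
      rw [hsup] at h1
      exact h1.trans (sup_le le_sup_left ((Ideal.span_singleton_le_iff_mem _).mpr hum))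
    have hlt := spanFinrank_span_image_erase_lt (fun j => x j - c j * u) i
    rw [← hKdef, hKeq, hcard] at hlt
    exact lt_irrefl _ hlt

end Local
end MinimalReductions

/-! ### Bounding the number of generators by the growth of `R/Jⁿ` -/

section Counting
open MvPolynomial

variable {R : Type*} [CommRing R]

/-- If monomials in `x` are independent modulo `𝔪`, then any set of monomials of degree less than
`N` bounds the length of `R/Jᴺ` from below. -/
lemma card_le_coheight_pow [IsLocalRing R] {J : Ideal R} (hJ : J ≤ maximalIdeal R) {ι : Type*}
    {x : ι → R} (hx : ∀ i, x i ∈ J)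
    (hind : ∀ (m : ℕ) (f : MvPolynomial ι R), (∀ s ∈ f.support, s.degree = m) →
      eval x f ∈ maximalIdeal R * J ^ m → ∀ s, coeff s f ∈ maximalIdeal R)
    {N : ℕ} (T : Finset (ι →₀ ℕ)) (hT : ∀ s ∈ T, s.degree < N) :
    (T.card : ℕ∞) ≤ Order.coheight (J ^ N) := by
  classical
  set μ : (ι →₀ ℕ) → R := fun s => s.prod fun i k => x i ^ k with hμ
  suffices H : Order.coheight (J ^ N ⊔ Ideal.span (μ '' T)) + T.card ≤ Order.coheight (J ^ N) from
    le_add_self.trans H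
  revert hT
  -- Coheight in the lattice of ideals is the length of the quotient. Each new monomial has the
  -- least degree so far and enlarges the ideal strictly: in a relation, terms of higher degree fall
  -- into `𝔪J^deg a`, leaving a homogeneous polynomial with coefficient 1 at `a`, against `hind`.
  induction T using Finset.induction_on_min_value (fun s : ι →₀ ℕ => s.degree) with
  | empty => simp
  | insert a T haT hmin ih =>
    intro hT
    have ih' := ih fun s hs => hT s (Finset.mem_insert_of_mem hs)
    set B := J ^ N ⊔ Ideal.span (μ '' T) with hB
    have hle : B ≤ J ^ N ⊔ Ideal.span (μ '' (insert a T : Finset (ι →₀ ℕ))) :=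
      sup_le_sup_left (Ideal.span_mono (Set.image_mono (by simp))) _
    have hamem : μ a ∈ J ^ N ⊔ Ideal.span (μ '' (insert a T : Finset (ι →₀ ℕ))) :=
      Submodule.mem_sup_right (Ideal.subset_span ⟨a, by simp, rfl⟩)
    have ha : μ a ∉ B := by
      intro haB
      obtain ⟨p, hp, q, hq, hpq⟩ := Submodule.mem_sup.mp haB
      obtain ⟨c, rfl⟩ := (Submodule.mem_span_image_finset_iff_exists_fun R).mp hq
      let c' : (ι →₀ ℕ) → R := fun s => if h : s ∈ T then c ⟨s, h⟩ else 0
      have hc' : ∑ i : T, c i • μ i = ∑ s ∈ T, c' s * μ s := by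
        rw [← Finset.sum_coe_sort T]
        exact Finset.sum_congr rfl fun s _ => by simp [c']
      let f : MvPolynomial ι R := monomial a 1 -
        ∑ s ∈ T.filter (fun s => s.degree = a.degree), monomial s (c' s)
      have hsupp : ∀ s ∈ f.support, s.degree = a.degree := by
        intro s hs
        by_contra hne
        rw [mem_support_iff] at hs
        apply hs
        rw [coeff_sub, coeff_sum, coeff_monomial, if_neg (fun h : a = s => hne (h ▸ rfl)), zero_sub,
          neg_eq_zero]
        refine Finset.sum_eq_zero fun t ht => ?_
        rw [coeff_monomial, if_neg]
        rintro rfl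
        exact hne (Finset.mem_filter.mp ht).2
      have hev : eval x f ∈ maximalIdeal R * J ^ a.degree := by
        have hstep : J ^ (a.degree + 1) ≤ maximalIdeal R * J ^ a.degree := by
          rw [pow_succ']
          exact Ideal.mul_mono_left hJ
        have h1 : eval x f = p + ∑ s ∈ T.filter (fun s => ¬ s.degree = a.degree), c' s * μ s := by
          have h2 := Finset.sum_filter_add_sum_filter_not T (fun s => s.degree = a.degree)
            (fun s => c' s * μ s)
          simp only [f, map_sub, map_sum, eval_monomial, one_mul]
          rw [hc', ← h2] at hpq
          change μ a - ∑ s ∈ T.filter (fun s => s.degree = a.degree), c' s * μ s = _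
          rw [← hpq]
          ring
        rw [h1]
        refine add_mem (hstep (Ideal.pow_le_pow_right (hT a (by simp)) hp))
          (sum_mem fun s hs => Ideal.mul_mem_left _ _ (hstep ?_))
        obtain ⟨hsT, hsne⟩ := Finset.mem_filter.mp hs
        exact Ideal.pow_le_pow_right (lt_of_le_of_ne (hmin s hsT) (Ne.symm hsne))
          (prod_pow_mem_pow hx s)
      have hcoeff := hind _ f hsupp hev a
      have hone : coeff a f = 1 := by
        rw [coeff_sub, coeff_sum, coeff_monomial, if_pos rfl, Finset.sum_eq_zero, sub_zero]
        intro t ht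
        rw [coeff_monomial, if_neg]
        rintro rfl
        exact haT (Finset.mem_filter.mp ht).1
      rw [hone] at hcoeff
      exact (Ideal.ne_top_iff_one _).mp (maximalIdeal.isMaximal R).ne_top hcoeff
    have hlt := lt_of_le_not_ge hle fun h => ha (h hamem)
    calc _ = Order.coheight (J ^ N ⊔ Ideal.span (μ '' (insert a T : Finset (ι →₀ ℕ)))) + 1
          + T.card := by
            rw [Finset.card_insert_of_notMem haT, Nat.cast_add, Nat.cast_one, add_assoc,
              add_comm (1 : ℕ∞)]
      _ ≤ Order.coheight B + T.card := by
        gcongr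
        exact Order.coheight_add_one_le hlt
      _ ≤ _ := ih'

lemma length_le_add_of_exact {X Y Z : Type*} [AddCommGroup X] [AddCommGroup Y] [AddCommGroup Z]
    [Module R X] [Module R Y] [Module R Z] (f : X →ₗ[R] Y) (g : Y →ₗ[R] Z)
    (hg : Function.Surjective g) (h : Function.Exact f g) :
    Module.length R Y ≤ Module.length R X + Module.length R Z := by
  rw [Module.length_eq_add_of_exact (LinearMap.range f).subtype g (Submodule.subtype_injective _)
    hg (by rw [LinearMap.exact_iff, Submodule.range_subtype, LinearMap.exact_iff.mp h])]
  gcongr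
  exact Module.length_le_of_surjective f.rangeRestrict f.surjective_rangeRestrict

/-- Right exactness of `R/(𝔟, v) → R/(𝔟, uv) → R/(𝔟, u) → 0`, the first map being multiplication by
`u`. -/
lemma length_quotient_sup_span_mul_le (𝔟 : Ideal R) (u v : R) :
    Module.length R (R ⧸ 𝔟 ⊔ Ideal.span {u * v}) ≤
      Module.length R (R ⧸ 𝔟 ⊔ Ideal.span {v}) + Module.length R (R ⧸ 𝔟 ⊔ Ideal.span {u}) := by
  have hle : 𝔟 ⊔ Ideal.span {v} ≤
      Submodule.comap (LinearMap.lsmul R R u) (𝔟 ⊔ Ideal.span {u * v}) := by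
    refine sup_le (fun b hb => Submodule.mem_sup_left (Ideal.mul_mem_left _ _ hb)) ?_
    rw [Ideal.span_le, Set.singleton_subset_iff]
    exact Submodule.mem_sup_right (Ideal.mem_span_singleton_self _)
  have hrange : (𝔟 ⊔ Ideal.span {u * v}) ⊔ LinearMap.range (LinearMap.lsmul R R u) =
      𝔟 ⊔ Ideal.span {u} := by
    have h1 : LinearMap.range (LinearMap.lsmul R R u) = Ideal.span {u} := by
      ext y
      simp [Ideal.mem_span_singleton', mul_comm]
    have h2 : Ideal.span {u * v} ≤ Ideal.span {u} :=
      Ideal.span_singleton_le_span_singleton.mpr (Dvd.intro _ rfl)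
    rw [h1, sup_assoc, sup_eq_right.mpr h2]
  exact length_le_add_of_exact _ _ (Submodule.factor_surjective _)
    (Submodule.exact_mapQ_factor _ _ _ _ hle hrange)

lemma length_quotient_sup_span_pow_le (𝔟 : Ideal R) (u : R) (n : ℕ) :
    Module.length R (R ⧸ 𝔟 ⊔ Ideal.span {u ^ n}) ≤
      n * Module.length R (R ⧸ 𝔟 ⊔ Ideal.span {u}) := by
  induction n with
  | zero =>
    have : Subsingleton (R ⧸ 𝔟 ⊔ Ideal.span {u ^ 0}) := by
      rw [Ideal.Quotient.subsingleton_iff]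
      simp
    simp [Module.length_eq_zero]
  | succ n ih =>
    rw [pow_succ]
    refine (length_quotient_sup_span_mul_le 𝔟 _ _).trans ?_
    rw [Nat.cast_add, Nat.cast_one, add_mul, one_mul, add_comm]
    gcongr

lemma length_quotient_sup_span_image_pow_le (𝔟 : Ideal R) (s : Finset R) (n : ℕ) :
    Module.length R (R ⧸ 𝔟 ⊔ Ideal.span ((fun y => y ^ n) '' (s : Set R))) ≤
      (n ^ s.card : ℕ) * Module.length R (R ⧸ 𝔟 ⊔ Ideal.span (s : Set R)) := by
  classical
  induction s using Finset.induction_on generalizing 𝔟 with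
  | empty => rw [Finset.coe_empty, Set.image_empty]; simp
  | insert a s ha ih =>
    rw [Finset.coe_insert, Set.image_insert_eq, Ideal.span_insert, Ideal.span_insert, ← sup_assoc,
      Finset.card_insert_of_notMem ha]
    refine (ih _).trans ?_
    rw [sup_right_comm, ← sup_assoc, sup_right_comm 𝔟 (Ideal.span {a}), pow_succ, Nat.cast_mul,
      mul_assoc]
    gcongr
    exact length_quotient_sup_span_pow_le _ _ _

lemma le_of_forall_pow_le {μ d C : ℕ} (h : ∀ n : ℕ, (n + 1) ^ μ ≤ C * (n + 1) ^ d) : μ ≤ d := by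
  by_contra! hlt
  -- The choice `n = C` already contradicts `μ > d`.
  have h1 : (C + 1) ^ (d + 1) ≤ C * (C + 1) ^ d :=
    (Nat.pow_le_pow_right C.succ_pos hlt).trans (h C)
  rw [pow_succ'] at h1
  have := Nat.le_of_mul_le_mul_right h1 (by positivity)
  omega

/-- A minimal reduction of an `𝔪`-primary ideal is generated by `dim R` elements. -/
lemma IsMinimalReduction.spanFinrank_le [IsLocalRing R] [IsNoetherianRing R]
    [Infinite (ResidueField R)] {I J : Ideal R} (hJ : IsMinimalReduction I J)
    (hrad : J.radical = maximalIdeal R) {d : ℕ} (hd : ringKrullDim R = d) :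
    J.spanFinrank ≤ d := by
  classical
  have hJm : J ≤ maximalIdeal R := hrad ▸ Ideal.le_radical
  obtain ⟨T, hT, hspan⟩ :=
    (IsNoetherian.noetherian J).exists_span_finset_card_eq_spanFinrank
  have hx : Ideal.span (Set.range fun t : T => (t : R)) = J := by
    rw [Subtype.range_coe_subtype]
    exact hspan
  have hxJ : ∀ t : T, (t : R) ∈ J := fun t => hspan ▸ Submodule.subset_span t.2
  have hind := fun m f hf hfx => hJ.coeff_mem_maximalIdeal hx (by rw [Fintype.card_coe, hT])
    (m := m) (f := f) hf hfx
  -- A system of parameters `s`. Since `𝔪ᴺ ⊆ J`, the powers `y^(Nn)` for `y ∈ s` lie in `Jⁿ`, so the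
  -- length of `R/Jⁿ` is at most `(Nn)ᵈe`.
  obtain ⟨s, hs, hscard⟩ := (maximalIdeal R).exists_finset_card_eq_height_of_isNoetherianRing
  have hsd : s.card = d := by
    have := maximalIdeal_height_eq_ringKrullDim (R := R)
    rw [hd, ← hscard] at this
    exact_mod_cast this
  obtain ⟨N, hN⟩ := J.exists_radical_pow_le_of_fg (IsNoetherian.noetherian _)
  rw [hrad] at hN
  have hart := quotient_artinian_of_mem_minimalPrimes_of_isLocalRing _ hs
  have hfin : Module.length R (R ⧸ Ideal.span (s : Set R)) ≠ ⊤ := by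
    rw [Module.length_eq_of_surjective (R := R ⧸ Ideal.span (s : Set R))
      (Ideal.Quotient.mk_surjective)]
    exact Module.length_ne_top
  obtain ⟨e, he⟩ := ENat.ne_top_iff_exists.mp hfin
  have hupper : ∀ n, Order.coheight (J ^ n) ≤ ((N * n) ^ d * e : ℕ) := by
    intro n
    have hle : Ideal.span ((fun y => y ^ (N * n)) '' (s : Set R)) ≤ J ^ n := by
      rw [Ideal.span_le]
      rintro _ ⟨y, hy, rfl⟩
      have hym : y ∈ maximalIdeal R := hs.1.2 (Ideal.subset_span hy)
      simp only [pow_mul]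
      exact Ideal.pow_mem_pow (hN (Ideal.pow_mem_pow hym N)) n
    refine (Order.coheight_anti hle).trans ?_
    rw [← Module.length_quotient]
    have := length_quotient_sup_span_image_pow_le ⊥ s (N * n)
    rw [bot_sup_eq, bot_sup_eq, hsd, ← he] at this
    exact_mod_cast this
  rw [← hT]
  set μ := T.card with hμ
  refine le_of_forall_pow_le (C := (N * (μ + 1)) ^ d * e) fun n => ?_
  -- The `(n + 1)^μ` monomials with all exponents at most `n` have degree at most `μn`, so they
  -- bound the length of `R/J^(μn+1)` from below. The constant `C` above comes from `μn + 1 ≤ (μ +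
  -- 1)(n + 1)`.
  let M : Finset (T →₀ ℕ) := (Finset.univ : Finset (T → Fin (n + 1))).map
    ⟨fun g => Finsupp.equivFunOnFinite.symm fun t => (g t : ℕ), fun g g' h => by
      funext t
      exact Fin.ext (DFunLike.congr_fun h t)⟩
  have hM : M.card = (n + 1) ^ μ := by simp [M, hμ]
  have hdeg : ∀ g ∈ M, g.degree < μ * n + 1 := by
    intro g hg
    obtain ⟨g, -, rfl⟩ := Finset.mem_map.mp hg
    rw [Nat.lt_succ_iff, Finsupp.degree_eq_sum]
    calc _ ≤ ∑ _t : T, n := Finset.sum_le_sum fun t _ => Nat.lt_succ_iff.mp (g t).2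
      _ = μ * n := by simp [hμ]
  have hlow := (card_le_coheight_pow hJm hxJ hind M hdeg).trans (hupper _)
  rw [hM] at hlow
  have hlow' : (n + 1) ^ μ ≤ (N * (μ * n + 1)) ^ d * e := by exact_mod_cast hlow
  refine hlow'.trans ?_
  calc (N * (μ * n + 1)) ^ d * e ≤ (N * ((μ + 1) * (n + 1))) ^ d * e := by
        gcongr
        nlinarith
    _ = (N * (μ + 1)) ^ d * e * (n + 1) ^ d := by
        rw [← mul_assoc, mul_pow _ (n + 1)]
        ring

end Counting

/-! ### Regular generators of `J` in depth at least `d` -/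

section CohenMacaulay
universe u
variable {R : Type u} [CommRing R]

lemma IsRegularChain.extend {x : ℕ → R} {𝔧 : ℕ → Ideal R} {d : ℕ} {K : Ideal R}
    (hc : IsRegularChain x 𝔧 d K) {y : R} (hy : ∀ z, y * z ∈ K → z ∈ K) :
    IsRegularChain (Function.update x d y) (Function.update 𝔧 (d + 1) (K ⊔ Ideal.span {y}))
      (d + 1) (K ⊔ Ideal.span {y}) where
  zero := by rw [Function.update_of_ne (by omega), hc.zero]
  succ i hi := by
    obtain hi | rfl := Nat.lt_succ_iff_lt_or_eq.mp hi
    · rw [Function.update_of_ne (by omega), Function.update_of_ne (by omega),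
        Function.update_of_ne (by omega), hc.succ i hi]
    · rw [Function.update_self, Function.update_self, Function.update_of_ne (by omega), hc.top]
  top := Function.update_self _ _ _
  regular i hi := by
    obtain hi | rfl := Nat.lt_succ_iff_lt_or_eq.mp hi
    · rw [Function.update_of_ne (by omega), Function.update_of_ne (by omega)]
      exact hc.regular i hi
    · rw [Function.update_self, Function.update_of_ne (by omega), hc.top]
      exact hy

variable [IsLocalRing R] [IsNoetherianRing R] {J K : Ideal R}

/-- Such a prime would be `𝔪`, and an embedding of `R/𝔪` in `R/K` is a nonzero element of `Ext⁰`. -/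
lemma not_le_of_mem_associatedPrimes (hJ : J.radical = maximalIdeal R) {n : ℕ}
    (hext : ExtVanishesBelow (maximalIdeal R) (R ⧸ K) (n + 1)) {P : Ideal R}
    (hP : P ∈ associatedPrimes R (R ⧸ K)) : ¬ J ≤ P := by
  intro hle
  have hprime : P.IsPrime := hP.isPrime
  have hPm : P = maximalIdeal R := by
    refine le_antisymm (le_maximalIdeal hprime.ne_top) ?_
    rw [← hJ]
    exact hprime.radical_le_iff.mpr hle
  subst hPm
  have hsub := subsingleton_ext_zero_iff.mp (hext 0 n.succ_pos)
  obtain ⟨-, z, hz⟩ := (isAssociatedPrime_iff_exists_injective_linearMap _ _).mp hP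
  have := Subsingleton.elim z 0
  subst this
  have h01 : (1 : R ⧸ maximalIdeal R) = 0 := hz rfl
  exact one_ne_zero h01

/-- Prime avoidance for the associated primes of `R/K` together with `K + 𝔪J`, which need not be
prime. Avoiding the latter lets `y` replace a generator of `J` over `K`. -/
lemma exists_isSMulRegular_of_extVanishesBelow (hJ : J.radical = maximalIdeal R) (hK : K ≤ J)
    {n : ℕ}
    (hext : ExtVanishesBelow (maximalIdeal R) (R ⧸ K) (n + 1)) :
    ∃ y ∈ J, y ∉ K ⊔ maximalIdeal R * J ∧ IsSMulRegular (R ⧸ K) y := by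
  classical
  have hfin := associatedPrimes.finite R (R ⧸ K)
  have hJm : J ≤ maximalIdeal R := hJ ▸ Ideal.le_radical
  have hJK : ¬ J ≤ K ⊔ maximalIdeal R * J := by
    intro h
    have hJK := le_of_le_sup_maximalIdeal_mul h
    have : Nontrivial (R ⧸ K) := Ideal.Quotient.nontrivial_iff.mpr
      (ne_top_of_le_ne_top (maximalIdeal.isMaximal R).ne_top (hK.trans hJm))
    obtain ⟨P, hP⟩ := associatedPrimes.nonempty R (R ⧸ K)
    refine not_le_of_mem_associatedPrimes hJ hext hP (hJK.trans ?_)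
    have := hP.annihilator_le
    rwa [Submodule.annihilator_top, Ideal.annihilator_quotient] at this
  have hav := (Ideal.subset_union_prime (s := insert (K ⊔ maximalIdeal R * J) hfin.toFinset)
    (f := id) (I := J) (K ⊔ maximalIdeal R * J) (K ⊔ maximalIdeal R * J) (by
      intro P hP hne _
      obtain rfl | hP := Finset.mem_insert.mp hP
      · exact absurd rfl hne
      · exact (hfin.mem_toFinset.mp hP).isPrime)).not.mpr (by
    rintro ⟨P, hP, hle⟩
    obtain rfl | hP := Finset.mem_insert.mp hP
    · exact hJK hle
    · exact not_le_of_mem_associatedPrimes hJ hext (hfin.mem_toFinset.mp hP) hle)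
  obtain ⟨y, hyJ, hy⟩ := Set.not_subset.mp hav
  simp only [Set.mem_iUnion, not_exists, Finset.coe_insert, id] at hy
  refine ⟨y, hyJ, hy _ (Set.mem_insert _ _), ?_⟩
  by_contra hreg
  have : y ∈ ⋃ p ∈ associatedPrimes R (R ⧸ K), (p : Set R) := by
    rw [biUnion_associatedPrimes_eq_compl_regular]
    exact hreg
  simp only [Set.mem_iUnion] at this
  obtain ⟨P, hP, hyP⟩ := this
  exact hy P (Set.mem_insert_of_mem _ (hfin.mem_toFinset.mpr hP)) hyP

omit [IsNoetherianRing R] in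
/-- Exchange lemma for generators of an ideal of a local ring. -/
lemma exists_exchange {T : Finset R} (hT : J = K ⊔ Ideal.span T) {y : R} (hy : y ∈ J)
    (hy' : y ∉ K ⊔ maximalIdeal R * J) :
    ∃ T' : Finset R, T'.card + 1 = T.card ∧ J = K ⊔ Ideal.span {y} ⊔ Ideal.span T' := by
  classical
  have hTJ : ∀ t ∈ T, t ∈ J := fun t ht => hT ▸ Submodule.mem_sup_right (Ideal.subset_span ht)
  have hKJ : K ≤ J := hT ▸ le_sup_left
  obtain ⟨k, hk, e, he, hke⟩ := Submodule.mem_sup.mp (hT ▸ hy)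
  obtain ⟨c, -, rfl⟩ := Submodule.mem_span_finset.mp he
  obtain ⟨t, ht, hunit⟩ : ∃ t ∈ T, IsUnit (c t) := by
    by_contra! hni
    refine hy' (hke ▸ add_mem (Submodule.mem_sup_left hk) (Submodule.mem_sup_right ?_))
    exact sum_mem fun t ht => Ideal.mul_mem_mul (hni t ht) (hTJ t ht)
  refine ⟨T.erase t, Finset.card_erase_add_one ht, le_antisymm ?_ ?_⟩
  · have hmem : ∀ s ∈ T, s ≠ t → s ∈ K ⊔ Ideal.span {y} ⊔ Ideal.span (T.erase t : Set R) :=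
      fun s hs hst => Submodule.mem_sup_right (Ideal.subset_span (by simp [hs, hst]))
    have hkmem : K ≤ K ⊔ Ideal.span {y} ⊔ Ideal.span (T.erase t : Set R) :=
      le_sup_left.trans le_sup_left
    conv_lhs => rw [hT]
    refine sup_le hkmem (Ideal.span_le.mpr fun s hs => ?_)
    by_cases hst : s = t
    · subst hst
      refine (Ideal.unit_mul_mem_iff_mem _ hunit).mp ?_
      have hs' : c s * s = y - k - ∑ a ∈ T.erase s, c a • a := by
        rw [← hke, ← Finset.add_sum_erase T _ ht, smul_eq_mul]
        ring
      rw [hs']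
      refine sub_mem (sub_mem ?_ (hkmem hk)) (sum_mem fun a ha => Ideal.mul_mem_left _ _
        (hmem a (Finset.mem_of_mem_erase ha) (Finset.ne_of_mem_erase ha)))
      exact Submodule.mem_sup_left (Submodule.mem_sup_right (Ideal.mem_span_singleton_self y))
    · exact hmem s hs hst
  · refine sup_le (sup_le hKJ ((Ideal.span_singleton_le_iff_mem _).mpr hy)) ?_
    exact Ideal.span_le.mpr fun s hs => hTJ s (Finset.mem_of_mem_erase hs)

omit [IsNoetherianRing R] in
lemma extVanishesBelow_quotient_sup {y : R} (hy : IsSMulRegular (R ⧸ K) y) {n : ℕ}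
    (hext : ExtVanishesBelow (maximalIdeal R) (R ⧸ K) (n + 1)) :
    ExtVanishesBelow (maximalIdeal R) (R ⧸ K ⊔ Ideal.span {y}) n := by
  have hle : K ≤ Submodule.comap (LinearMap.lsmul R R y) K := fun z hz => Ideal.mul_mem_left _ _ hz
  have hrange : K ⊔ LinearMap.range (LinearMap.lsmul R R y) = K ⊔ Ideal.span {y} := by
    congr 1
    ext z
    simp [Ideal.mem_span_singleton', mul_comm]
  have hmap : Submodule.mapQ _ _ _ hle = LinearMap.lsmul R (R ⧸ K) y := by
    ext
    rfl
  have hex := Submodule.exact_mapQ_factor _ _ _ _ hle hrange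
  rw [hmap] at hex
  exact ExtVanishesBelow.of_exact_right (LinearMap.lsmul R _ y) _ hy (Submodule.factor_surjective _) hex
    (hext.mono n.le_succ) hext

/-- In a local ring of depth at least `d`, an `𝔪`-primary ideal with `d` generators is generated
by a regular sequence of length `d`. -/
lemma exists_isRegularChain (hJ : J.radical = maximalIdeal R) {d : ℕ}
    (hext : ExtVanishesBelow (maximalIdeal R) R d) (hgen : J.spanFinrank ≤ d) :
    ∃ x 𝔧, IsRegularChain x 𝔧 d J := by
  -- The depth left in `R/K` and the number of generators left for `J` over `K` decrease together,
  -- so at `i = d` no generators remain.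
  suffices H : ∀ i ≤ d, ∃ x 𝔧 K, IsRegularChain x 𝔧 i K ∧
      ExtVanishesBelow (maximalIdeal R) (R ⧸ K) (d - i) ∧
        ∃ T : Finset R, T.card ≤ d - i ∧ J = K ⊔ Ideal.span T by
    obtain ⟨x, 𝔧, K, hc, -, T, hT, hJK⟩ := H d le_rfl
    rw [Nat.sub_self, Nat.le_zero, Finset.card_eq_zero] at hT
    subst hT
    rw [Finset.coe_empty, Ideal.span_empty, sup_bot_eq] at hJK
    exact ⟨x, 𝔧, hJK ▸ hc⟩
  intro i
  induction i with
  | zero =>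
    intro _
    obtain ⟨T, hT, hspan⟩ :=
      (IsNoetherian.noetherian J).exists_span_finset_card_eq_spanFinrank
    refine ⟨0, ⊥, ⊥, ⟨rfl, by simp, rfl, by simp⟩, ?_, T, by omega, ?_⟩
    · exact hext.congr (Submodule.quotEquivOfEqBot ⊥ rfl).symm
    · rw [bot_sup_eq]
      exact hspan.symm
  | succ i ih =>
    intro hi
    obtain ⟨x, 𝔧, K, hc, hK, T, hT, hJK⟩ := ih (by omega)
    rw [show d - i = d - (i + 1) + 1 by omega] at hK hT
    obtain ⟨y, hyJ, hy, hreg⟩ := exists_isSMulRegular_of_extVanishesBelow hJ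
      (hJK ▸ le_sup_left) hK
    obtain ⟨T', hT', hJ'⟩ := exists_exchange hJK hyJ hy
    refine ⟨_, _, _, hc.extend (y := y) ?_, extVanishesBelow_quotient_sup hreg hK, T',
      by omega, hJ'⟩
    intro z hz
    have := isSMulRegular_iff_right_eq_zero_of_smul.mp hreg (Ideal.Quotient.mk K z) (by
      rw [← Ideal.Quotient.eq_zero_iff_mem] at hz
      exact hz)
    rwa [Ideal.Quotient.eq_zero_iff_mem] at this

end CohenMacaulay

/-! ### Grade in quotients of the Rees algebra -/

section Grade
universe u
open RingTheory.Sequence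

variable {A B : Type u} [CommRing A] [CommRing B] [Algebra A B]

lemma exists_list_map_eq_of_mem_map (hsurj : Function.Surjective (algebraMap A B)) {𝔐 : Ideal A}
    (rs : List B) (hrs : ∀ r ∈ rs, r ∈ 𝔐.map (algebraMap A B)) :
    ∃ rs' : List A, rs'.map (algebraMap A B) = rs ∧ ∀ r ∈ rs', r ∈ 𝔐 := by
  induction rs with
  | nil => exact ⟨[], rfl, by simp⟩
  | cons r rs ih =>
    obtain ⟨rs', hmap, hmem⟩ := ih fun x hx => hrs x (List.mem_cons_of_mem _ hx)
    obtain ⟨a, ha, rfl⟩ := (Ideal.mem_map_iff_of_surjective _ hsurj).mp (hrs r List.mem_cons_self)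
    exact ⟨a :: rs', by simp [hmap], by simpa using ⟨ha, hmem⟩⟩

/-- Rees' characterization of the grade of the image of `𝔐` in a quotient `B` of `A`. -/
lemma le_idealGrade_map_iff [IsNoetherianRing A] (hsurj : Function.Surjective (algebraMap A B))
    {𝔐 : Ideal A} (h𝔐 : 𝔐.map (algebraMap A B) ≠ ⊤) {n : ℕ} :
    (n : ℕ∞) ≤ idealGrade (𝔐.map (algebraMap A B)) ↔ ExtVanishesBelow 𝔐 B n := by
  have hfin : Module.Finite A B := Module.Finite.of_surjective (Algebra.linearMap A B) hsurj
  have hlt : 𝔐 • (⊤ : Submodule A B) < ⊤ := by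
    rw [lt_top_iff_ne_top, Ideal.smul_top_eq_map]
    intro h
    exact h𝔐 (Submodule.restrictScalars_injective A B B (h.trans rfl))
  constructor
  · intro hn
    cases n with
    | zero => intro i hi; omega
    | succ n =>
      have hlt' : (n : ℕ∞) < idealGrade (𝔐.map (algebraMap A B)) :=
        lt_of_lt_of_le (by exact_mod_cast n.lt_succ_self) hn
      simp only [idealGrade, lt_iSup_iff, Nat.cast_lt] at hlt'
      obtain ⟨rs, ⟨hmem, hreg⟩, hlen⟩ := hlt'
      -- Regular sequences are lifted to `A` because Ext is taken over `A`, the common ring over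
      -- which different quotients can be compared.
      obtain ⟨rs', rfl, hmem'⟩ := exists_list_map_eq_of_mem_map hsurj rs hmem
      have hweak := (isWeaklyRegular_map_algebraMap_iff (S := B) B rs').mp hreg.toIsWeaklyRegular
      rw [List.length_map] at hlen
      refine ((extVanishesBelow_iff_exists_isRegular hlt).mpr
        ⟨rs', rfl, hmem', ⟨hweak, fun h => hlt.ne (top_le_iff.mp ?_)⟩⟩).mono hlen
      have hle : Ideal.ofList rs' ≤ 𝔐 := Ideal.span_le.mpr fun r hr => hmem' r hr
      exact h.le.trans (Submodule.smul_mono_left hle)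
  · intro hext
    obtain ⟨rs, rfl, hmem, hreg⟩ := (extVanishesBelow_iff_exists_isRegular hlt).mp hext
    have hmem' : ∀ r ∈ rs.map (algebraMap A B), r ∈ 𝔐.map (algebraMap A B) := by
      intro r hr
      obtain ⟨a, ha, rfl⟩ := List.mem_map.mp hr
      exact Ideal.mem_map_of_mem _ (hmem a ha)
    refine le_iSup₂_of_le (rs.map (algebraMap A B)) ⟨hmem', ⟨?_, fun h => h𝔐 (top_le_iff.mp ?_)⟩⟩
      (by simp)
    · exact (isWeaklyRegular_map_algebraMap_iff (S := B) B rs).mpr hreg.toIsWeaklyRegular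
    · rw [h, smul_eq_mul, Ideal.mul_top]
      exact Ideal.span_le.mpr fun r hr => hmem' r hr

open Polynomial in
/-- If `J` is generated by a regular sequence of length `d` and `J ∩ 𝔞Iⁿ⁺¹ = J𝔞Iⁿ` for all `n`,
then the grade of `⨁ₙ Iⁿ/𝔞Iⁿ` exceeds that of the associated graded ring as long as the latter is
less than `d`. -/
lemma IsReesAlgebra.succ_le_idealGrade {R A : Type u} [CommRing R] [CommRing A]
    [IsNoetherianRing A] [Algebra A R[X]] {𝔞 I J : Ideal R} (hA : IsReesAlgebra A I) (h : I ≤ 𝔞)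
    {𝔐 : Ideal A} (h𝔐 : ∀ a, (algebraMap A R[X] a).coeff 0 = 0 → a ∈ 𝔐)
    (hI𝔐 : 𝔐.map (Ideal.Quotient.mk (hA.coeffIdeal I)) ≠ ⊤)
    (h𝔞𝔐 : 𝔐.map (Ideal.Quotient.mk (hA.coeffIdeal 𝔞)) ≠ ⊤)
    {x : ℕ → R} {𝔧 : ℕ → Ideal R} {d : ℕ} (hc : IsRegularChain x 𝔧 d J) (hJI : J ≤ I)
    (hJF : ∀ n, J ⊓ 𝔞 * I ^ n ≤ J * shiftedFiltration 𝔞 I n) {s : ℕ} (hs : s < d)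
    (hG : (s : ℕ∞) ≤ idealGrade (𝔐.map (Ideal.Quotient.mk (hA.coeffIdeal I)))) :
    ((s + 1 : ℕ) : ℕ∞) ≤ idealGrade (𝔐.map (Ideal.Quotient.mk (hA.coeffIdeal 𝔞))) := by
  have h1 := (le_idealGrade_map_iff (B := A ⧸ hA.coeffIdeal I) Ideal.Quotient.mk_surjective
    hI𝔐).mp hG
  refine (le_idealGrade_map_iff (B := A ⧸ hA.coeffIdeal 𝔞) Ideal.Quotient.mk_surjective
    h𝔞𝔐).mpr (hA.extVanishesBelow_quotient h 𝔐 ?_ h1)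
  exact (hA.extVanishesBelow_shifted h 𝔐 h𝔐 hc hJI hJF).mono hs

end Grade

/-! ### The fiber cone and the main theorem -/

section FiberCone
open Polynomial

variable {R : Type*} [CommRing R]

lemma isReesAlgebra_reesAlgebra (I : Ideal R) : IsReesAlgebra (reesAlgebra I) I where
  injective := Subtype.val_injective
  mem_range_iff f := by
    constructor
    · rintro ⟨a, rfl⟩
      exact a.2
    · intro hf
      exact ⟨⟨f, hf⟩, rfl⟩

lemma homogeneousMaximalIdeal_ne_top [IsLocalRing R] {𝔞 I : Ideal R} (h : 𝔞 ≤ maximalIdeal R) :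
    homogeneousMaximalIdeal 𝔞 I ≠ ⊤ := by
  intro htop
  have hcomap := congrArg (Ideal.comap (Ideal.Quotient.mk (reesCoeffIdeal 𝔞 I))) htop
  rw [homogeneousMaximalIdeal, Ideal.comap_map_of_surjective _ Ideal.Quotient.mk_surjective,
    Ideal.comap_top, sup_eq_left.mpr] at hcomap
  · exact Ideal.comap_ne_top _ (maximalIdeal.isMaximal R).ne_top hcomap
  · intro f hf
    have := (Ideal.Quotient.eq_zero_iff_mem.mp hf) 0
    rw [pow_zero, mul_one] at this
    exact h this

lemma succ_le_depthFiberCone [IsLocalRing R] [IsNoetherianRing R] {I J : Ideal R}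
    (hI : I ≤ maximalIdeal R) {x : ℕ → R} {𝔧 : ℕ → Ideal R} {d : ℕ}
    (hc : IsRegularChain x 𝔧 d J) (hJI : J ≤ I)
    (hJF : ∀ n, 1 ≤ n → maximalIdeal R * I ^ n ⊓ J ≤ maximalIdeal R * I ^ (n - 1) * J)
    {s : ℕ} (hs : s < d) (hG : (s : ℕ∞) ≤ depthAssociatedGraded I) :
    ((s + 1 : ℕ) : ℕ∞) ≤ depthFiberCone I := by
  refine (isReesAlgebra_reesAlgebra I).succ_le_idealGrade hI (𝔐 := (maximalIdeal R).comap
    (Polynomial.constantCoeff.comp (algebraMap (reesAlgebra I) R[X]))) ?_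
    (homogeneousMaximalIdeal_ne_top hI) (homogeneousMaximalIdeal_ne_top le_rfl) hc hJI ?_ hs hG
  · intro a ha
    rw [Ideal.mem_comap, RingHom.comp_apply, Polynomial.constantCoeff_apply, ha]
    exact zero_mem _
  · intro n
    cases n with
    -- In degree 0 the filtration is all of `R`, so the condition is just `J ∩ 𝔪 ⊆ J`.
    | zero => simp [shiftedFiltration]
    | succ n =>
      rw [inf_comm, shiftedFiltration, mul_comm J]
      exact hJF (n + 1) (by omega)

lemma mul_pow_two_eq_of_reductionNumberWrt_eq_one {𝔞 I J : Ideal R}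
    (h : reductionNumberWrt 𝔞 I J = 1) : 𝔞 * I ^ 2 = 𝔞 * (J * I) := by
  -- The infimum of an empty set would be 0, so the value 1 is attained.
  have hne : {n : ℕ | I ^ (n + 1) • (⊤ : Submodule R 𝔞) =
      (J * I ^ n) • (⊤ : Submodule R 𝔞)}.Nonempty :=
    Nat.nonempty_of_pos_sInf (Nat.one_pos.trans_eq (h.symm : 1 = sInf _))
  have hmem := Nat.sInf_mem hne
  rw [show sInf _ = 1 from h] at hmem
  have := congrArg (Submodule.map (Submodule.subtype 𝔞)) hmem
  rw [Submodule.map_smul'', Submodule.map_smul'', Submodule.map_top, Submodule.range_subtype,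
    smul_eq_mul, smul_eq_mul, pow_one] at this
  rw [mul_comm, this, mul_comm]

/-- For `n ≥ 2` the whole of `𝔪Iⁿ` equals `𝔪Iⁿ⁻¹J`; the case `n = 1` is `J ∩ 𝔪I ⊆ 𝔪J`, where
minimality enters. -/
lemma IsMinimalReduction.maximalIdeal_mul_pow_inf_le [IsLocalRing R] [IsNoetherianRing R]
    {I J : Ideal R} (hJ : IsMinimalReduction I J)
    (h : maximalIdeal R * I ^ 2 = maximalIdeal R * (J * I)) (n : ℕ) (hn : 1 ≤ n) :
    maximalIdeal R * I ^ n ⊓ J ≤ maximalIdeal R * I ^ (n - 1) * J := by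
  obtain ⟨n, rfl⟩ := Nat.exists_eq_add_of_le' hn
  rw [Nat.add_sub_cancel]
  cases n with
  | zero => simpa [inf_comm] using hJ.inf_maximalIdeal_mul_le
  | succ n =>
    refine inf_le_left.trans (le_of_eq ?_)
    calc maximalIdeal R * I ^ (n + 1 + 1) = maximalIdeal R * I ^ 2 * I ^ n := by ring
      _ = maximalIdeal R * I ^ (n + 1) * J := by rw [h]; ring

lemma IsMinimalReduction.radical_eq [IsLocalRing R] {I J : Ideal R} (hJ : IsMinimalReduction I J)
    (hI : IsMaximalPrimary I) : J.radical = maximalIdeal R := by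
  obtain ⟨hJI, n, hn⟩ := isReductionWrt_self_iff.mp hJ.prop
  rw [← hI.2]
  refine le_antisymm (Ideal.radical_mono hJI) ?_
  rw [← Ideal.radical_pow I n.succ_ne_zero, Nat.succ_eq_add_one, hn]
  exact Ideal.radical_mono Ideal.mul_le_left

end FiberCone

theorem corollary3p2 {R : Type*} [CommRing R] [IsLocalRing R]
    [Infinite (IsLocalRing.ResidueField R)] (hCM : IsCohenMacaulayLocal R)
    (d : ℕ) (hdim : ringKrullDim R = (d : WithBot ℕ∞)) (hd : 1 ≤ d)
    (I J : Ideal R) (hI : IsMaximalPrimary I) (hJ : IsMinimalReduction I J) :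
    ((∀ n : ℕ, 1 ≤ n →
        IsLocalRing.maximalIdeal R * I ^ n ⊓ J = IsLocalRing.maximalIdeal R * I ^ (n - 1) * J) →
      0 < depthFiberCone I) ∧
    (reductionNumberWrt (IsLocalRing.maximalIdeal R) I J = 1 →
      ∀ t : ℕ, 1 ≤ t → t ≤ d →
        ((d - t : ℕ) : ℕ∞) ≤ depthAssociatedGraded I →
        ((d - t + 1 : ℕ) : ℕ∞) ≤ depthFiberCone I) := by
  have hnoeth := hCM.noetherian
  have hrad := hJ.radical_eq hI
  have hIm : I ≤ maximalIdeal R := hI.2 ▸ Ideal.le_radical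
  have hJI : J ≤ I := hJ.prop.1
  have hgrade : (d : ℕ∞) ≤ idealGrade ((maximalIdeal R).map (algebraMap R R)) := by
    have := hCM.depth_eq_dim
    rw [hdim] at this
    rw [Algebra.algebraMap_self, Ideal.map_id]
    exact (WithBot.coe_injective this).ge
  have hext : ExtVanishesBelow (maximalIdeal R) R d :=
    (le_idealGrade_map_iff Function.surjective_id (by
      rw [Algebra.algebraMap_self, Ideal.map_id]
      exact (maximalIdeal.isMaximal R).ne_top)).mp hgrade
  obtain ⟨x, 𝔧, hc⟩ := exists_isRegularChain hrad hext (hJ.spanFinrank_le hrad hdim)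
  refine ⟨fun h => ?_, fun h t ht htd hG => ?_⟩
  -- With `s = 0` the condition on `depth G(I)` is empty; part (2) takes `s = d - t`, which is less
  -- than `d` because `t ≥ 1`.
  · have := succ_le_depthFiberCone (s := 0) hIm hc hJI (fun n hn => (h n hn).le) hd (by simp)
    exact lt_of_lt_of_le (by simp) this
  · exact succ_le_depthFiberCone hIm hc hJI
      (hJ.maximalIdeal_mul_pow_inf_le (mul_pow_two_eq_of_reductionNumberWrt_eq_one h))
      (by omega) hG
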